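/- **Setting.** Let $I$ be a set, $P$ a free abelian group and $(a_{ij})_{i,j\in I}$ an integral matrix with $a_{ii}=2$, $a_{ij}\le 0$ for $i\neq j$, $a_{ij}=0$ if $a_{ji}=0$, together with integers $d_i>0$ such that $d_ia_{ij}=d_ja_{ji}$. Let $\alpha_i\in P$ be linearly independent and $h_i\in\mathrm{Hom}(P,\mathbb Z)$ with $\langle h_i,\alpha_j\rangle=a_{ij}$, and let $I=I_{\rm even}\sqcup I_{\rm odd}$ with $a_{ij}\in 2\mathbb Z$ for $i\in I_{\rm odd}$, $j\in I$. Put $\mathrm p(i)=1$ for odd $i$, $\mathrm p(i)=0$ for even $i$, $Q^+=\sum_i\mathbb Z_{\ge0}\alpha_i$, $Q^-=-Q^+$. Let $(\,|\,)$ be a symmetric $\mathbb Q$-valued bilinear form on $P$ with $(\alpha_i|\lambda)=d_i\langle h_i,\lambda\rangle$, let $\rho\in P$ satisfy $\langle h_i,\rho\rangle=1$ for all $i$, and let $N\ge1$ be an integer with $N\big((\lambda+\rho|\lambda+\rho)-(\rho|\rho)\big)\in\mathbb Z$ for all $\lambda\in P$. The base ring is $\mathbf k=\mathbb Q(q^{1/N})\otimes\mathbb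 Z[\sqrt\pi]$ with $(\sqrt\pi)^4=1$, $\pi=(\sqrt\pi)^2$ (so $\mathbf k=\mathbb Q(q)^{\sqrt\pi}$ if $N=1$). Put $\pi_i=\pi^{\mathrm p(i)}$, fix $\sqrt{\pi_i}\in\mathbb Z[\sqrt\pi]$ with $(\sqrt{\pi_i})^2=\pi_i$, and put $$q_i=q^{d_i},\qquad p_i=q_i\sqrt{\pi_i},\qquad \theta_{ii}=1,\qquad \theta_{ij}=\sqrt{\pi_j}^{\,a_{ji}}\ (i\ne j).$$ **The algebra.** $\mathbf U$ is the $\mathbf k$-algebra with generators $e_i,f_i,K_i^{\pm1}$ $(i\in I)$ and relations $$K_iK_j=K_jK_i,\quad K_ie_jK_i^{-1}=p_i^{a_{ij}}e_j,\quad K_if_jK_i^{-1}=p_i^{-a_{ij}}f_j,\quad e_if_j-\theta_{ji}f_je_i=\delta_{ij}\frac{K_i-K_i^{-1}}{p_i-p_i^{-1}},$$ $$\sum_{k=0}^{1-a_{ij}}(-\theta_{ji})^kf_i^{(1-a_{ij}-k)}f_jf_i^{(k)}=0,\qquad \sum_{k=0}^{1-a_{ij}}(-\theta_{ij})^ke_i^{(1-a_{ij}-k)}e_je_i^{(k)}=0\qquad(i\ne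 j),$$ where $x_i^{(k)}=x_i^k/\prod_{m=1}^k\frac{p_i^m-p_i^{-m}}{p_i-p_i^{-1}}$. It is graded by $e_i\in\mathbf U_{\alpha_i}$, $f_i\in\mathbf U_{-\alpha_i}$, $K_i^{\pm1}\in\mathbf U_0$. Let $\mathbf U^-$ be the subalgebra generated by the $f_i$. Let $\psi$ be the automorphism of $\mathbf U$ with $\psi(e_i)=f_iK_i^{-1}$, $\psi(f_i)=K_ie_i$, $\psi(K_i)=K_i^{-1}$, and let $\tau_i$ be the automorphism with $\tau_i(e_j)=\theta_{ji}^{-1}e_j$, $\tau_i(f_j)=\theta_{ji}f_j$, $\tau_i(K_j)=K_j$. For $R\in\mathbf U^-$ the elements $E_i^*(R),E_i'(R)\in\mathbf U^-$ are determined by $$e_iR-\tau_i(R)e_i=\tau_i(E_i^*(R))K_i-K_i^{-1}E_i'(R).$$ Let $(\,,\,)$ be the unique symmetric bilinear form on $\mathbf U^-$ with $(1,1)=1$, $(E_i'R,S)=(R,f_iS)$ and $(E_i^*R,S)=(R,Sf_i)$ for all $i\in I$ and $R,S\in\mathbf U^-$; it is non-degenerate. **The operators.** Let $\Psi:Q^-\to\mathbf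 k^\times$ be the unique function with $\Psi(0)=1$ and $\Psi(\beta-\alpha_i)=a_i(\beta)^{-1}\Psi(\beta)$, where $a_i(\sum_jm_j\alpha_j)=\prod_j\theta_{ji}^{-m_j}\cdot p_i^{-\langle h_i,\sum_j m_j\alpha_j\rangle}$. Let $t:P\to\{1,\pi\}$ be a function with $t(\lambda)/t(\lambda-\alpha_i)=\pi_i^{\langle h_i,\lambda\rangle}$ for all $i\in I$, $\lambda\in P$. Let $\{A_\nu\}$ be a basis of $\mathbf U^-$ consisting of weight vectors, $A_\nu\in\mathbf U^-_{\mathrm{wt}(A_\nu)}$, and let $\{A'_\nu\}$ be its dual basis with respect to $(\,,\,)$. Let $M$ be a module in $\mathcal O^P(\mathbf U)$, i.e. a $\mathbf U$-module with a decomposition $M=\bigoplus_{\lambda\in P}M_\lambda$ such that $\mathbf U_\alpha M_\lambda\subset M_{\lambda+\alpha}$, $K_i$ acts on $M_\lambda$ by $p_i^{\langle h_i,\lambda\rangle}$, every $M_\lambda$ is finitely generated over $\mathbf k$, and there are $\lambda_1,\dots,\lambda_s\in P$ such that all weights of $M$ lie in $\bigcup_r(\lambda_r-Q^+)$. Define operators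 on $M$ by $$\Phi=\sum_\nu\Psi(\mathrm{wt}(A_\nu))\,A'_\nu\,\psi(A_\nu),\qquad \Xi|_{M_\lambda}=t(\lambda)\,q^{(\lambda+\rho|\lambda+\rho)-(\rho|\rho)}\,\mathrm{id}_{M_\lambda},\qquad \Omega=\Phi\,\Xi .$$ **Theorem.** For every $M$ in $\mathcal O^P(\mathbf U)$ the sum defining $\Phi$ is finite on each vector of $M$, and the quantum Casimir operator $\Omega$ satisfies $$\Omega e_i=e_i\Omega\qquad\text{and}\qquad \Omega f_i=f_i\Omega\qquad\text{on } M,\ \text{for all } i\in I.$$ -/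

import Mathlib

open scoped Polynomial

namespace QuantumSuper

noncomputable section

/-! ### The base ring -/

/-- The ring `ℚ(v)^{√π} = ℚ(v) ⊗ ℤ[√π]`, where `(√π)^4 = 1`. The variable `v` is `RatFunc.X`. -/
abbrev BaseRing : Type := AdjoinRoot ((Polynomial.X : (RatFunc ℚ)[X]) ^ 4 - 1)

/-- The indeterminate `v` as a unit of the base ring. -/
def vUnit : BaseRingˣ :=
  Units.map (algebraMap (RatFunc ℚ) BaseRing).toMonoidHom
    (Units.mk0 (RatFunc.X : RatFunc ℚ) RatFunc.X_ne_zero)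

theorem root_pow_four :
    (AdjoinRoot.root ((Polynomial.X : (RatFunc ℚ)[X]) ^ 4 - 1)) ^ 4 = 1 := by
  have h := AdjoinRoot.eval₂_root ((Polynomial.X : (RatFunc ℚ)[X]) ^ 4 - 1)
  simpa [sub_eq_zero] using h

/-- The element `√π` as a unit. -/
def sqrtPi : BaseRingˣ where
  val := AdjoinRoot.root _
  inv := AdjoinRoot.root _ ^ 3
  val_inv := by rw [← pow_succ']; exact root_pow_four
  inv_val := by rw [← pow_succ]; exact root_pow_four

/-- The element `π = (√π)^2`, which satisfies `π^2 = 1`. -/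
def piUnit : BaseRingˣ := sqrtPi ^ 2

theorem piUnit_sq : piUnit ^ 2 = 1 := by
  apply Units.ext
  have h := root_pow_four
  simp only [piUnit, sqrtPi, Units.val_pow_eq_pow_val, Units.val_one, ← pow_mul]
  exact h

/-! ### Cartan superdata -/

/-- A Cartan superdatum with index set `I` and weight lattice `P`
(the freeness of `P` over `ℤ` is a separate hypothesis). -/
structure CartanSuperdatum (I P : Type*) [AddCommGroup P] where
  /-- The Cartan matrix. -/
  a : I → I → ℤ
  a_diag : ∀ i, a i i = 2
  a_nonpos : ∀ i j, i ≠ j → a i j ≤ 0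
  a_zero : ∀ i j, a j i = 0 → a i j = 0
  /-- The symmetrizing integers. -/
  d : I → ℤ
  d_pos : ∀ i, 0 < d i
  d_symm : ∀ i j, d i * a i j = d j * a j i
  /-- The simple roots. -/
  α : I → P
  /-- The simple coroots. -/
  h : I → (P →+ ℤ)
  pairing : ∀ i j, h i (α j) = a i j
  α_linearIndependent : LinearIndependent ℤ α
  /-- The set of odd indices. -/
  odd : Set I
  a_even : ∀ i ∈ odd, ∀ j, Even (a i j)

/-- A Cartan superdatum, together with a positive integer `N` such that `q = v ^ N`
(so the base ring is `ℚ(q^{1/N})^{√π}`, which is `ℚ(q)^{√π}` for `N = 1`),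
and a choice of square roots `√π_i ∈ ℤ[√π]` of `π_i = π^{p(i)}`. -/
structure Setup (I P : Type*) [AddCommGroup P] extends CartanSuperdatum I P where
  N : ℕ
  N_pos : 0 < N
  sqrtPiOf : I → BaseRingˣ
  sqrtPiOf_mem : ∀ i, (sqrtPiOf i : BaseRing) ∈ Subring.closure {(sqrtPi : BaseRing)}
  sqrtPiOf_sq : ∀ i, open Classical in
    sqrtPiOf i ^ 2 = piUnit ^ (if i ∈ odd then 1 else 0 : ℕ)

variable {I P : Type*} [AddCommGroup P] (S : Setup I P)

namespace Setup

open Classical in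
/-- The parity function. -/
def parity (i : I) : ℕ := if i ∈ S.odd then 1 else 0

/-- `π_i = π^{p(i)}`. -/
def piOf (i : I) : BaseRingˣ := piUnit ^ S.parity i

/-- The quantum parameter `q = v ^ N`. -/
def q : BaseRingˣ := vUnit ^ S.N

/-- `p_i = q_i √π_i`, where `q_i = q^{d_i}`. -/
def p (i : I) : BaseRingˣ := S.q ^ S.d i * S.sqrtPiOf i

open Classical in
/-- `θ_{ij} = (√π_j)^{a_{ji}}` for `i ≠ j`, and `θ_{ii} = 1`. -/
def θ (i j : I) : BaseRingˣ := if i = j then 1 else S.sqrtPiOf j ^ S.a j i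

/-- The element `∑ n_i α_i` of the positive root lattice `Q⁺`. -/
def rootOf (β : I →₀ ℕ) : P := β.sum fun i n => n • S.α i

/-- The quantum integer `[n]_{a, b} = (a^n - b^n) / (a - b)` at `a = p_i`, `b = p_i⁻¹`. -/
def qInt (i : I) (n : ℕ) : BaseRing :=
  ∑ m ∈ Finset.range n, (S.p i : BaseRing) ^ (n - 1 - m) * ((S.p i)⁻¹ : BaseRingˣ) ^ m

/-- The quantum factorial `[n]!`. -/
def qFactorial (i : I) (n : ℕ) : BaseRing := ∏ m ∈ Finset.range n, S.qInt i (m + 1)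

/-- The divided power `x^{(n)} = x^n / [n]!` (the quantum factorials are invertible). -/
def divPow {A : Type*} [Ring A] [Algebra BaseRing A] (i : I) (n : ℕ) (x : A) : A :=
  Ring.inverse (S.qFactorial i n) • x ^ n

/-- The Serre element `∑_{m=0}^{1-a_{ij}} (-c)^m x^{(1-a_{ij}-m)} y x^{(m)}`. -/
def serre {A : Type*} [Ring A] [Algebra BaseRing A] (i j : I) (c : BaseRing) (x y : A) : A :=
  ∑ m ∈ Finset.range ((1 - S.a i j).toNat + 1),
    (-c) ^ m • (S.divPow i ((1 - S.a i j).toNat - m) x * y * S.divPow i m x)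

end Setup

/-! ### The algebra `𝐔` -/

/-- Names of the generators `e_i, f_i, K_i, K_i⁻¹`. -/
inductive Gen (I : Type*) : Type _
  | e (i : I)
  | f (i : I)
  | K (i : I)
  | Kinv (i : I)

/-- The weight of a generator. -/
def Gen.wt : Gen I → P
  | .e i => S.α i
  | .f i => -S.α i
  | .K _ => 0
  | .Kinv _ => 0

/-- A generator as an element of the free algebra. -/
abbrev gen (x : Gen I) : FreeAlgebra BaseRing (Gen I) := FreeAlgebra.ι BaseRing x

open Classical in
/-- The defining relations of `𝐔`. -/
inductive Rel : FreeAlgebra BaseRing (Gen I) → FreeAlgebra BaseRing (Gen I) → Prop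
  | K_mul_Kinv (i : I) : Rel (gen (.K i) * gen (.Kinv i)) 1
  | Kinv_mul_K (i : I) : Rel (gen (.Kinv i) * gen (.K i)) 1
  | K_comm (i j : I) : Rel (gen (.K i) * gen (.K j)) (gen (.K j) * gen (.K i))
  | K_e (i j : I) :
      Rel (gen (.K i) * gen (.e j) * gen (.Kinv i)) (S.p i ^ S.a i j • gen (.e j))
  | K_f (i j : I) :
      Rel (gen (.K i) * gen (.f j) * gen (.Kinv i)) (S.p i ^ (-S.a i j) • gen (.f j))
  | e_f (i j : I) :
      Rel (gen (.e i) * gen (.f j) - S.θ j i • (gen (.f j) * gen (.e i)))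
        (if i = j then
          Ring.inverse ((S.p i : BaseRing) - ((S.p i)⁻¹ : BaseRingˣ)) •
            (gen (.K i) - gen (.Kinv i))
        else 0)
  | serre_f (i j : I) (hij : i ≠ j) :
      Rel (S.serre i j (S.θ j i) (gen (.f i)) (gen (.f j))) 0
  | serre_e (i j : I) (hij : i ≠ j) :
      Rel (S.serre i j (S.θ i j) (gen (.e i)) (gen (.e j))) 0

/-- The quantum superalgebra `𝐔`. -/
def U : Type _ := RingQuot (Rel S)

instance : Ring (U S) := inferInstanceAs (Ring (RingQuot (Rel S)))

instance : Algebra BaseRing (U S) := inferInstanceAs (Algebra BaseRing (RingQuot (Rel S)))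

namespace U

/-- The canonical map from the free algebra. -/
def mk : FreeAlgebra BaseRing (Gen I) →ₐ[BaseRing] U S := RingQuot.mkAlgHom BaseRing (Rel S)

/-- A generator as an element of `𝐔`. -/
def ofGen (x : Gen I) : U S := mk S (gen x)

/-- The generator `e_i`. -/
abbrev e (i : I) : U S := ofGen S (.e i)
/-- The generator `f_i`. -/
abbrev f (i : I) : U S := ofGen S (.f i)
/-- The generator `K_i`. -/
abbrev K (i : I) : U S := ofGen S (.K i)
/-- The generator `K_i⁻¹`. -/
abbrev Kinv (i : I) : U S := ofGen S (.Kinv i)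

/-- The universal property of `𝐔`. -/
def lift {A : Type*} [Ring A] [Algebra BaseRing A] (g : Gen I → A)
    (hg : ∀ x y, Rel S x y → FreeAlgebra.lift BaseRing g x = FreeAlgebra.lift BaseRing g y) :
    U S →ₐ[BaseRing] A :=
  RingQuot.liftAlgHom BaseRing ⟨FreeAlgebra.lift BaseRing g, fun x y h => hg x y h⟩


variable {S} in
theorem rel_eq {x y : FreeAlgebra BaseRing (Gen I)} (h : Rel S x y) : mk S x = mk S y :=
  RingQuot.mkAlgHom_rel BaseRing h

theorem K_mul_Kinv (i : I) : K S i * Kinv S i = 1 := by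
  simpa [ofGen] using rel_eq (Rel.K_mul_Kinv (S := S) i)

theorem Kinv_mul_K (i : I) : Kinv S i * K S i = 1 := by
  simpa [ofGen] using rel_eq (Rel.Kinv_mul_K (S := S) i)

theorem K_comm (i j : I) : K S i * K S j = K S j * K S i := by
  simpa [ofGen] using rel_eq (Rel.K_comm (S := S) i j)

theorem K_e (i j : I) : K S i * e S j = (S.p i ^ S.a i j : BaseRingˣ) • (e S j * K S i) := by
  have h := rel_eq (Rel.K_e (S := S) i j)
  simp only [map_mul, Units.smul_def, map_smul] at h
  have h2 := congrArg (· * K S i) h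
  simp only [mul_assoc] at h2
  change K S i * (e S j * (Kinv S i * K S i)) = _ at h2
  rw [Kinv_mul_K, mul_one, smul_mul_assoc] at h2
  exact h2

theorem K_f (i j : I) : K S i * f S j = (S.p i ^ (-S.a i j) : BaseRingˣ) • (f S j * K S i) := by
  have h := rel_eq (Rel.K_f (S := S) i j)
  simp only [map_mul, Units.smul_def, map_smul] at h
  have h2 := congrArg (· * K S i) h
  simp only [mul_assoc] at h2
  change K S i * (f S j * (Kinv S i * K S i)) = _ at h2
  rw [Kinv_mul_K, mul_one, smul_mul_assoc] at h2
  exact h2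

theorem e_K (i j : I) : e S j * K S i = (S.p i ^ (-S.a i j) : BaseRingˣ) • (K S i * e S j) := by
  rw [K_e, smul_smul, ← zpow_add]; simp

theorem f_K (i j : I) : f S j * K S i = (S.p i ^ (S.a i j) : BaseRingˣ) • (K S i * f S j) := by
  rw [K_f, smul_smul, ← zpow_add]; simp

theorem Kinv_e (i j : I) :
    Kinv S i * e S j = (S.p i ^ (-S.a i j) : BaseRingˣ) • (e S j * Kinv S i) := by
  have h : Kinv S i * (e S j * K S i) * Kinv S i
      = Kinv S i * ((S.p i ^ (-S.a i j) : BaseRingˣ) • (K S i * e S j)) * Kinv S i := by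
    rw [e_K]
  rw [mul_smul_comm, smul_mul_assoc, ← mul_assoc (Kinv S i) (K S i), Kinv_mul_K, one_mul] at h
  rw [← h, mul_assoc, mul_assoc, K_mul_Kinv, mul_one]

theorem Kinv_f (i j : I) :
    Kinv S i * f S j = (S.p i ^ (S.a i j) : BaseRingˣ) • (f S j * Kinv S i) := by
  have h : Kinv S i * (f S j * K S i) * Kinv S i
      = Kinv S i * ((S.p i ^ (S.a i j) : BaseRingˣ) • (K S i * f S j)) * Kinv S i := by
    rw [f_K]
  rw [mul_smul_comm, smul_mul_assoc, ← mul_assoc (Kinv S i) (K S i), Kinv_mul_K, one_mul] at h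
  rw [← h, mul_assoc, mul_assoc, K_mul_Kinv, mul_one]

theorem e_Kinv (i j : I) :
    e S j * Kinv S i = (S.p i ^ (S.a i j) : BaseRingˣ) • (Kinv S i * e S j) := by
  rw [Kinv_e, smul_smul, ← zpow_add]; simp

theorem f_Kinv (i j : I) :
    f S j * Kinv S i = (S.p i ^ (-S.a i j) : BaseRingˣ) • (Kinv S i * f S j) := by
  rw [Kinv_f, smul_smul, ← zpow_add]; simp

theorem K_Kinv (i j : I) : K S i * Kinv S j = Kinv S j * K S i := by
  have h : Kinv S j * (K S j * K S i) * Kinv S j = Kinv S j * (K S i * K S j) * Kinv S j := by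
    rw [K_comm]
  rw [← mul_assoc, Kinv_mul_K, one_mul, mul_assoc, mul_assoc (K S i), K_mul_Kinv, mul_one] at h
  exact h

theorem Kinv_comm (i j : I) : Kinv S i * Kinv S j = Kinv S j * Kinv S i := by
  have h : Kinv S i * (K S i * Kinv S j) * Kinv S i
      = Kinv S i * (Kinv S j * K S i) * Kinv S i := by rw [K_Kinv]
  rw [← mul_assoc, Kinv_mul_K, one_mul, mul_assoc, mul_assoc (Kinv S j), K_mul_Kinv,
    mul_one] at h
  exact h.symm

open Classical in
theorem e_f (i j : I) : e S i * f S j - S.θ j i • (f S j * e S i) =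
    if i = j then Ring.inverse ((S.p i : BaseRing) - ((S.p i)⁻¹ : BaseRingˣ)) •
      (K S i - Kinv S i) else 0 := by
  have h := rel_eq (Rel.e_f (S := S) i j)
  simp only [map_mul, map_sub, Units.smul_def, map_smul] at h
  rw [Units.smul_def]
  refine h.trans ?_
  split_ifs
  · simp only [map_smul, map_sub]; rfl
  · simp

theorem _root_.QuantumSuper.Setup.map_serre {A B : Type*} [Ring A] [Algebra BaseRing A] [Ring B]
    [Algebra BaseRing B] (φ : A →ₐ[BaseRing] B) (i j : I) (c : BaseRing) (x y : A) :
    φ (S.serre i j c x y) = S.serre i j c (φ x) (φ y) := by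
  simp [Setup.serre, Setup.divPow]

theorem serre_f (i j : I) (hij : i ≠ j) : S.serre i j (S.θ j i) (f S i) (f S j) = 0 := by
  have h := rel_eq (Rel.serre_f (S := S) i j hij)
  rwa [Setup.map_serre, map_zero] at h

theorem serre_e (i j : I) (hij : i ≠ j) : S.serre i j (S.θ i j) (e S i) (e S j) = 0 := by
  have h := rel_eq (Rel.serre_e (S := S) i j hij)
  rwa [Setup.map_serre, map_zero] at h

theorem _root_.QuantumSuper.Setup.serre_transfer {A : Type*} [Ring A] [Algebra BaseRing A]
    (i j : I) (c c' κ r : BaseRing) (x y x' y' T : A) (hc : c * r = c')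
    (hm : ∀ m k, m + k = (1 - S.a i j).toNat →
      x' ^ m * y' * x' ^ k = (κ * r ^ k) • (T * (x ^ m * y * x ^ k))) :
    S.serre i j c x' y' = κ • (T * S.serre i j c' x y) := by
  unfold Setup.serre Setup.divPow
  rw [Finset.mul_sum, Finset.smul_sum]
  refine Finset.sum_congr rfl fun k hk => ?_
  have hk' : ((1 - S.a i j).toNat - k) + k = (1 - S.a i j).toNat := by
    have := Finset.mem_range.mp hk; omega
  have h := hm _ _ hk'
  simp only [smul_mul_assoc, mul_smul_comm, smul_smul]
  rw [h, smul_smul, ← hc]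
  congr 1
  rw [neg_mul_eq_neg_mul, mul_pow]
  ring

theorem _root_.QuantumSuper.monomial_aux {R A : Type*} [CommRing R] [Ring A] [Algebra R A]
    (x y K L : A) (u w z : R) (hKL : K * L = L * K) (hxK : x * K = u • (K * x))
    (hyK : y * K = w • (K * y)) (hxL : x * L = z • (L * x)) (m k : ℕ) :
    (K * x) ^ m * (L * y) * (K * x) ^ k =
      (u ^ (∑ l ∈ Finset.range (m + k), l) * z ^ m * w ^ k) •
        (K ^ (m + k) * L * (x ^ m * y * x ^ k)) := by
  have hxKn (n : ℕ) : x * K ^ n = u ^ n • (K ^ n * x) := by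
    induction n with
    | zero => simp
    | succ n ih =>
      rw [pow_succ, ← mul_assoc, ih, smul_mul_assoc, mul_assoc, hxK, mul_smul_comm, smul_smul,
        pow_succ u, mul_assoc (K ^ n)]
  have hxkK (n : ℕ) : x ^ n * K = u ^ n • (K * x ^ n) := by
    induction n with
    | zero => simp
    | succ n ih =>
      rw [pow_succ', mul_assoc, ih, mul_smul_comm, ← mul_assoc, hxK, smul_mul_assoc, smul_smul,
        pow_succ u, mul_assoc]
  have hKLn (n : ℕ) : K ^ n * L = L * K ^ n := (Commute.pow_left (show Commute K L from hKL) n)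
  induction m with
  | zero =>
    simp only [pow_zero, one_mul, zero_add, mul_one]
    induction k with
    | zero => simp
    | succ k ih =>
      have e1 : y * x ^ k * (K * x) = (u ^ k * w) • (K * (y * x ^ (k + 1))) := by
        calc y * x ^ k * (K * x) = y * (x ^ k * K) * x := by simp only [mul_assoc]
          _ = u ^ k • ((y * K) * x ^ k * x) := by
              rw [hxkK]; simp only [mul_smul_comm, smul_mul_assoc, mul_assoc]
          _ = _ := by
              rw [hyK]; simp only [smul_mul_assoc, mul_assoc, smul_smul, pow_succ x]
      rw [pow_succ, ← mul_assoc, ih, smul_mul_assoc, mul_assoc (K ^ k * L), e1, mul_smul_comm,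
        smul_smul, Finset.sum_range_succ, pow_add]
      congr 1
      · ring
      · rw [hKLn, hKLn, pow_succ K]; simp only [mul_assoc]
  | succ m ih =>
    have e1 : K * x * (K ^ (m + k) * L * (x ^ m * y * x ^ k)) =
        (u ^ (m + k) * z) • (K ^ (m + 1 + k) * L * (x ^ (m + 1) * y * x ^ k)) := by
      calc _ = K * (x * K ^ (m + k)) * L * (x ^ m * y * x ^ k) := by simp only [mul_assoc]
        _ = u ^ (m + k) • (K * K ^ (m + k) * (x * L) * (x ^ m * y * x ^ k)) := by
            rw [hxKn]; simp only [mul_smul_comm, smul_mul_assoc, mul_assoc]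
        _ = _ := by
            rw [hxL]
            simp only [smul_mul_assoc, mul_smul_comm, smul_smul]
            rw [show m + 1 + k = (m + k) + 1 by omega, pow_succ' K, pow_succ' x]
            simp only [mul_assoc]
    rw [pow_succ', mul_assoc (K * x), mul_assoc (K * x), ih, mul_smul_comm, e1, smul_smul]
    rw [show m + 1 + k = (m + k) + 1 by omega, Finset.sum_range_succ, pow_add]
    congr 1
    ring

end U

namespace Setup

theorem piOf_sq (i : I) : S.piOf i ^ 2 = 1 := by
  rw [piOf, ← pow_mul, mul_comm, pow_mul, piUnit_sq, one_pow]

theorem sqrtPiOf_sq' (i : I) : S.sqrtPiOf i ^ 2 = S.piOf i := S.sqrtPiOf_sq i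

theorem piOf_zpow (i j : I) : S.piOf i ^ S.a i j = 1 := by
  by_cases hi : i ∈ S.odd
  · obtain ⟨m, hm⟩ := S.a_even i hi j
    have h2 : S.piOf i ^ (2 : ℤ) = 1 := by exact_mod_cast S.piOf_sq i
    rw [hm, ← two_mul, zpow_mul, h2, one_zpow]
  · simp [piOf, parity, hi]

theorem θ_self (i : I) : S.θ i i = 1 := by simp [θ]

theorem θ_sq (i j : I) : S.θ i j ^ 2 = 1 := by
  unfold θ
  split_ifs
  · simp
  · rw [← zpow_natCast, ← zpow_mul, mul_comm, zpow_mul, zpow_natCast, sqrtPiOf_sq', piOf_zpow]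

theorem θ_mul_self (i j : I) : S.θ i j * S.θ i j = 1 := by rw [← sq, θ_sq]

theorem θ_inv (i j : I) : (S.θ i j)⁻¹ = S.θ i j := inv_eq_of_mul_eq_one_right (S.θ_mul_self i j)

/-- `p_i^{a_{ij}} θ_{ij} = p_j^{a_{ji}} θ_{ji}`. -/
theorem p_θ (i j : I) : S.p i ^ S.a i j * S.θ i j = S.p j ^ S.a j i * S.θ j i := by
  by_cases h : i = j
  · subst h; rfl
  · have h' : j ≠ i := fun e => h e.symm
    simp only [p, θ, h, h', if_false, mul_zpow, ← zpow_mul, S.d_symm i j]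
    rw [mul_assoc, mul_assoc, mul_comm (S.sqrtPiOf i ^ S.a i j)]

theorem serre_conj {A : Type*} [Ring A] [Algebra BaseRing A] (i j : I) (c c' : BaseRing)
    (x y x' y' K L : A) (u w z cx cy : BaseRingˣ)
    (hKL : K * L = L * K) (hxK : x * K = u • (K * x))
    (hyK : y * K = w • (K * y)) (hxL : x * L = z • (L * x))
    (hx' : x' = cx • (K * x)) (hy' : y' = cy • (L * y))
    (hc : c * ((w / z : BaseRingˣ) : BaseRing) = c') (h0 : S.serre i j c' x y = 0) :
    S.serre i j c x' y' = 0 := by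
  set b := (1 - S.a i j).toNat with hb
  rw [S.serre_transfer i j c c' (((cx ^ b * cy * u ^ (∑ l ∈ Finset.range b, l) * z ^ b :
      BaseRingˣ) : BaseRing)) _ x y x' y' (K ^ b * L) hc, h0, mul_zero, smul_zero]
  intro m k hmk
  rw [hx', hy', smul_pow, smul_pow]
  simp only [Units.smul_def] at hxK hyK hxL ⊢
  simp only [smul_mul_assoc, mul_smul_comm, smul_smul]
  rw [monomial_aux x y K L _ _ _ hKL hxK hyK hxL, smul_smul, hmk, ← hb]
  congr 1
  rw [← hb] at hmk
  have : cx ^ k * (cy * cx ^ m) * (u ^ (∑ l ∈ Finset.range b, l) * z ^ m * w ^ k) =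
      cx ^ b * cy * u ^ (∑ l ∈ Finset.range b, l) * z ^ b * (w / z) ^ k := by
    generalize u ^ (∑ l ∈ Finset.range b, l) = t
    rw [← hmk, pow_add, pow_add, div_pow, div_eq_mul_inv]
    calc _ = cx ^ m * cx ^ k * cy * t * z ^ m * w ^ k := by ac_rfl
      _ = cx ^ m * cx ^ k * cy * t * z ^ m * w ^ k * (z ^ k * (z ^ k)⁻¹) := by
          rw [mul_inv_cancel, mul_one]
      _ = _ := by ac_rfl
  have h2 := congrArg (Units.val) this
  push_cast at h2 ⊢
  rw [← h2]

end Setup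

/-! ### The automorphism `ψ` and the operators `Ad(T_i)⁻¹` -/

/-- `p_i^{a_{ij}} θ_{ji} = p_j^{a_{ji}} θ_{ij}`. -/
theorem Setup.p_θ' (i j : I) : S.p i ^ S.a i j * S.θ j i = S.p j ^ S.a j i * S.θ i j := by
  have h := congrArg (· * (S.θ i j * S.θ j i)) (S.p_θ i j)
  calc S.p i ^ S.a i j * S.θ j i = S.p i ^ S.a i j * S.θ j i * (S.θ i j * S.θ i j) := by
        rw [S.θ_mul_self, mul_one]
    _ = S.p i ^ S.a i j * S.θ i j * (S.θ i j * S.θ j i) := by ac_rfl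
    _ = S.p j ^ S.a j i * S.θ j i * (S.θ i j * S.θ j i) := h
    _ = S.p j ^ S.a j i * S.θ i j * (S.θ j i * S.θ j i) := by ac_rfl
    _ = _ := by rw [S.θ_mul_self, mul_one]

/-- The images of the generators under `ψ`. -/
def psiGen : Gen I → U S
  | .e i => U.f S i * U.Kinv S i
  | .f i => U.K S i * U.e S i
  | .K i => U.Kinv S i
  | .Kinv i => U.K S i

theorem psiGen_rel (x y : FreeAlgebra BaseRing (Gen I)) (h : Rel S x y) :
    FreeAlgebra.lift BaseRing (psiGen S) x = FreeAlgebra.lift BaseRing (psiGen S) y := by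
  have hratio (i j : I) : S.θ i j * (S.p i ^ (-S.a i j) / S.p j ^ (-S.a j i)) = S.θ j i := by
    have h := S.p_θ' i j
    rw [zpow_neg, zpow_neg, inv_div_inv, mul_div_assoc', div_eq_iff_eq_mul, mul_comm (S.θ j i),
      h, mul_comm]
  cases h with
  | K_mul_Kinv i => simp [psiGen, U.Kinv_mul_K]
  | Kinv_mul_K i => simp [psiGen, U.K_mul_Kinv]
  | K_comm i j => simp [psiGen, U.Kinv_comm S i j]
  | K_e i j =>
    simp only [map_mul, Units.smul_def, map_smul, FreeAlgebra.lift_ι_apply, psiGen]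
    rw [← mul_assoc, U.Kinv_f, smul_mul_assoc, smul_mul_assoc, mul_assoc, mul_assoc,
      ← U.K_Kinv, ← mul_assoc (U.Kinv S i), U.Kinv_mul_K, one_mul]
    rfl
  | K_f i j =>
    simp only [map_mul, Units.smul_def, map_smul, FreeAlgebra.lift_ι_apply, psiGen]
    rw [← mul_assoc, ← U.K_Kinv, mul_assoc (U.K S j), U.Kinv_e, mul_smul_comm, smul_mul_assoc,
      mul_assoc, mul_assoc, U.Kinv_mul_K, mul_one]
    rfl
  | e_f i j =>
    simp only [map_mul, map_sub, Units.smul_def, map_smul, FreeAlgebra.lift_ι_apply, psiGen]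
    simp only [← Units.smul_def]
    have e1 : U.f S i * U.Kinv S i * (U.K S j * U.e S j) =
        (S.p i ^ (-S.a i i) * S.p j ^ S.a j i) •
          (U.Kinv S i * U.K S j * (U.f S i * U.e S j)) := by
      rw [U.f_Kinv, smul_mul_assoc, mul_smul]
      congr 1
      rw [mul_assoc, ← mul_assoc (U.f S i), U.f_K]
      simp only [smul_mul_assoc, mul_smul_comm, mul_assoc]
    have e2 : U.K S j * U.e S j * (U.f S i * U.Kinv S i) =
        (S.p i ^ (-S.a i i) * S.p i ^ S.a i j) •
          (U.Kinv S i * U.K S j * (U.e S j * U.f S i)) := by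
      rw [U.f_Kinv, mul_smul_comm, mul_smul]
      congr 1
      rw [mul_assoc, ← mul_assoc (U.e S j), U.e_Kinv]
      simp only [smul_mul_assoc, mul_smul_comm]
      rw [← mul_assoc, ← mul_assoc, U.K_Kinv, mul_assoc, mul_assoc]
    have e3 : U.f S i * U.Kinv S i * (U.K S j * U.e S j) -
        S.θ j i • (U.K S j * U.e S j * (U.f S i * U.Kinv S i)) =
        -((S.p i ^ (-S.a i i) * (S.p j ^ S.a j i * S.θ i j)) • (U.Kinv S i * U.K S j *
          (U.e S j * U.f S i - S.θ i j • (U.f S i * U.e S j)))) := by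
      rw [e1, e2, mul_sub, smul_sub, mul_smul_comm, smul_smul, smul_smul, neg_sub]
      congr 2
      · rw [mul_assoc, mul_assoc, S.θ_mul_self, mul_one]
      · rw [← S.p_θ' i j]; ac_rfl
    rw [e3, U.e_f]
    by_cases hij : i = j
    · subst hij
      simp only [if_true, U.Kinv_mul_K, one_mul, S.θ_self, mul_one, ← zpow_add, neg_add_cancel,
        zpow_zero, one_smul, map_smul, map_sub, FreeAlgebra.lift_ι_apply]
      rw [← smul_neg, neg_sub]
      rfl
    · have hji : j ≠ i := fun h => hij h.symm
      simp [hij, hji]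
  | serre_f i j hij =>
    rw [Setup.map_serre, map_zero]
    simp only [FreeAlgebra.lift_ι_apply, psiGen]
    refine S.serre_conj i j _ (S.θ i j) (U.e S i) (U.e S j) _ _ (U.K S i) (U.K S j)
      (S.p i ^ (-S.a i i)) (S.p i ^ (-S.a i j)) (S.p j ^ (-S.a j i)) 1 1 (U.K_comm S i j)
      (U.e_K S i i) (U.e_K S i j) (U.e_K S j i) (by simp) (by simp) ?_ (U.serre_e S i j hij)
    have h : S.θ j i * (S.p i ^ (-S.a i j) / S.p j ^ (-S.a j i)) = S.θ i j := by
      rw [zpow_neg, zpow_neg, inv_div_inv, mul_div_assoc', div_eq_iff_eq_mul, mul_comm (S.θ i j),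
        S.p_θ, mul_comm]
    exact_mod_cast h
  | serre_e i j hij =>
    rw [Setup.map_serre, map_zero]
    simp only [FreeAlgebra.lift_ι_apply, psiGen]
    refine S.serre_conj i j _ (S.θ j i) (U.f S i) (U.f S j) _ _ (U.Kinv S i) (U.Kinv S j)
      (S.p i ^ (-S.a i i)) (S.p i ^ (-S.a i j)) (S.p j ^ (-S.a j i)) _ _ (U.Kinv_comm S i j)
      (U.f_Kinv S i i) (U.f_Kinv S i j) (U.f_Kinv S j i) (U.f_Kinv S i i) (U.f_Kinv S j j) ?_
      (U.serre_f S i j hij)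
    exact_mod_cast hratio i j

/-- The automorphism `ψ` of `𝐔`: `e_i ↦ f_i K_i⁻¹`, `f_i ↦ K_i e_i`, `K_i ↦ K_i⁻¹`. -/
def psi : U S →ₐ[BaseRing] U S := U.lift S (psiGen S) (psiGen_rel S)

/-- The images of the generators under `a ↦ T_i⁻¹ a T_i`. -/
def twistGen (i : I) : Gen I → U S
  | .e j => (S.θ j i)⁻¹ • U.e S j
  | .f j => S.θ j i • U.f S j
  | .K j => U.K S j
  | .Kinv j => U.Kinv S j

theorem twistGen_rel (l : I) (x y : FreeAlgebra BaseRing (Gen I)) (h : Rel S x y) :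
    FreeAlgebra.lift BaseRing (twistGen S l) x = FreeAlgebra.lift BaseRing (twistGen S l) y := by
  cases h with
  | K_mul_Kinv i => simp [twistGen, U.K_mul_Kinv]
  | Kinv_mul_K i => simp [twistGen, U.Kinv_mul_K]
  | K_comm i j => simp [twistGen, U.K_comm S i j]
  | K_e i j =>
    simp only [map_mul, Units.smul_def, map_smul, FreeAlgebra.lift_ι_apply, twistGen]
    simp only [← Units.smul_def, mul_smul_comm, smul_mul_assoc]
    rw [U.K_e, smul_mul_assoc, mul_assoc, U.K_mul_Kinv, mul_one, smul_comm]
  | K_f i j =>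
    simp only [map_mul, Units.smul_def, map_smul, FreeAlgebra.lift_ι_apply, twistGen]
    simp only [← Units.smul_def, mul_smul_comm, smul_mul_assoc]
    rw [U.K_f, smul_mul_assoc, mul_assoc, U.K_mul_Kinv, mul_one, smul_comm]
  | e_f i j =>
    simp only [map_mul, map_sub, Units.smul_def, map_smul, FreeAlgebra.lift_ι_apply, twistGen]
    simp only [← Units.smul_def]
    have e1 : (S.θ i l)⁻¹ • U.e S i * S.θ j l • U.f S j -
        S.θ j i • (S.θ j l • U.f S j * (S.θ i l)⁻¹ • U.e S i) =
        ((S.θ i l)⁻¹ * S.θ j l) • (U.e S i * U.f S j - S.θ j i • (U.f S j * U.e S i)) := by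
      rw [smul_sub]
      simp only [smul_mul_assoc, mul_smul_comm, smul_smul]
      congr 2 <;> ac_rfl
    rw [e1, U.e_f]
    by_cases hij : i = j
    · subst hij
      simp [twistGen]
    · simp [hij]
  | serre_f i j hij =>
    rw [Setup.map_serre, map_zero]
    simp only [FreeAlgebra.lift_ι_apply, twistGen]
    exact S.serre_conj i j _ _ (U.f S i) (U.f S j) _ _ 1 1 1 1 1 (S.θ i l) (S.θ j l)
      (by simp) (by simp) (by simp) (by simp) (by simp) (by simp) (by simp)
      (U.serre_f S i j hij)
  | serre_e i j hij =>
    rw [Setup.map_serre, map_zero]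
    simp only [FreeAlgebra.lift_ι_apply, twistGen]
    exact S.serre_conj i j _ _ (U.e S i) (U.e S j) _ _ 1 1 1 1 1 (S.θ i l)⁻¹ (S.θ j l)⁻¹
      (by simp) (by simp) (by simp) (by simp) (by simp) (by simp) (by simp)
      (U.serre_e S i j hij)

/-- The automorphism `a ↦ T_i⁻¹ a T_i` of `𝐔`, where `T_i` commutes with all `K_j` and
`T_i e_j T_i⁻¹ = θ_{ji} e_j`, `T_i f_j T_i⁻¹ = θ_{ji}⁻¹ f_j`. -/
def twist (i : I) : U S →ₐ[BaseRing] U S := U.lift S (twistGen S i) (twistGen_rel S i)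

/-! ### The subalgebra `𝐔⁻` and its bilinear form -/

/-- The subalgebra `𝐔⁻` generated by the `f_i`. -/
def Uminus : Subalgebra BaseRing (U S) := Algebra.adjoin BaseRing (Set.range (U.f S))

/-- The generator `f_i` as an element of `𝐔⁻`. -/
def fMinus (i : I) : Uminus S := ⟨U.f S i, Algebra.subset_adjoin ⟨i, rfl⟩⟩

/-- The weight space `𝐔⁻_{-β}` for `β ∈ Q⁺`: the span of all products `f_{i_1} ⋯ f_{i_r}`
with `α_{i_1} + ⋯ + α_{i_r} = β`. -/
def minusSpace (β : I →₀ ℕ) : Submodule BaseRing (Uminus S) :=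
  Submodule.span BaseRing
    {x | ∃ l : List I, (l.map fun i => Finsupp.single i 1).sum = β ∧ (l.map (fMinus S)).prod = x}

/-- `IsSkewDer S i P Q R` says that `Q = E_i^*(P)` and `R = E_i'(P)`: these are the elements of
`𝐔⁻` such that `e_i P - (T_i⁻¹ P T_i) e_i = (T_i⁻¹ Q T_i) K_i - K_i⁻¹ R`. -/
def IsSkewDer (i : I) (P Q R : Uminus S) : Prop :=
  U.e S i * P - twist S i P * U.e S i = twist S i Q * U.K S i - U.Kinv S i * R

/-- The properties that characterize the bilinear form on `𝐔⁻`: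
it is symmetric, `(1, 1) = 1`, `(E_i' P, X) = (P, f_i X)` and `(E_i^* P, X) = (P, X f_i)`. -/
structure IsCanonicalForm (B : LinearMap.BilinForm BaseRing (Uminus S)) : Prop where
  symm : ∀ x y, B x y = B y x
  one_one : B 1 1 = 1
  left : ∀ i P Q R, IsSkewDer S i P Q R → ∀ X, B R X = B P (fMinus S i * X)
  right : ∀ i P Q R, IsSkewDer S i P Q R → ∀ X, B Q X = B P (X * fMinus S i)

open Classical in
/-- The canonical bilinear form on `𝐔⁻`: the unique bilinear form with the above properties. -/
def canonicalForm : LinearMap.BilinForm BaseRing (Uminus S) :=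
  if h : ∃ B, IsCanonicalForm S B then h.choose else 0

/-! ### The weight function `Ψ` -/

/-- The function `a_i : Q⁻ → kˣ`, `a_i(∑ m_j α_j) = (∏ θ_{ji}^{-m_j}) p_i^{-⟨h_i, ∑ m_j α_j⟩}`,
evaluated at `-β = -∑ n_j α_j`. -/
def aFun (i : I) (β : I →₀ ℕ) : BaseRingˣ :=
  (β.prod fun j n => S.θ j i ^ n) * S.p i ^ (S.h i (S.rootOf β))

theorem rootOf_add (β γ : I →₀ ℕ) : S.rootOf (β + γ) = S.rootOf β + S.rootOf γ := by
  classical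
  unfold Setup.rootOf
  exact Finsupp.sum_add_index' (by simp) (by intros; rw [add_smul])

theorem aFun_add (i : I) (β γ : I →₀ ℕ) : aFun S i (β + γ) = aFun S i β * aFun S i γ := by
  classical
  unfold aFun
  rw [rootOf_add, map_add, zpow_add, Finsupp.prod_add_index' (by simp) (by intros; rw [pow_add])]
  exact mul_mul_mul_comm _ _ _ _

open Classical in
theorem aFun_eq (i : I) (β : I →₀ ℕ) : aFun S i β =
    S.q ^ (β.sum fun j n => S.d i * S.a i j * (n : ℤ)) *
      piUnit ^ (β.sum fun j n => (if i = j then (S.parity i : ℤ) else 0) * (n : ℤ)) := by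
  induction β using Finsupp.induction_linear with
  | zero => simp [aFun, Setup.rootOf]
  | add β γ hβ hγ =>
    rw [aFun_add, hβ, hγ, Finsupp.sum_add_index' (by simp) (by intros; push_cast; ring),
      Finsupp.sum_add_index' (by simp) (by intros; push_cast; ring), zpow_add, zpow_add]
    exact mul_mul_mul_comm _ _ _ _
  | single j n =>
    have h1 : S.θ j i * S.p i ^ S.a i j =
        S.q ^ (S.d i * S.a i j) * piUnit ^ (if i = j then (S.parity i : ℤ) else 0) := by
      by_cases h : i = j
      · subst h
        have h2 : S.sqrtPiOf i ^ (2 : ℤ) = S.piOf i := by exact_mod_cast S.sqrtPiOf_sq' i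
        rw [S.θ_self, S.a_diag, Setup.p, mul_zpow, ← zpow_mul, h2, Setup.piOf, one_mul,
          if_pos rfl, zpow_natCast]
      · have h' : j ≠ i := fun e => h e.symm
        have h2 := S.θ_mul_self j i
        simp only [Setup.θ, h', if_false] at h2
        simp only [Setup.θ, h', h, if_false, zpow_zero, mul_one, Setup.p, mul_zpow, ← zpow_mul]
        rw [mul_left_comm, h2, mul_one]
    rw [Finsupp.sum_single_index (by simp), Finsupp.sum_single_index (by simp),
      zpow_mul _ _ (n : ℤ), zpow_mul _ _ (n : ℤ), zpow_natCast, zpow_natCast, ← mul_pow, ← h1, aFun,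
      Finsupp.prod_single_index (by simp), Setup.rootOf, Finsupp.sum_single_index (by simp),
      map_nsmul, S.pairing, mul_pow, nsmul_eq_mul, mul_comm (n : ℤ), zpow_mul, zpow_natCast]

theorem exists_quadratic {J : Type*} (G : J → J → ℤ) (hG : ∀ i j, G i j = G j i) :
    ∃ E : (J →₀ ℕ) → ℤ, E 0 = 0 ∧
      ∀ i β, E (β + Finsupp.single i 1) = E β + β.sum fun j n => G i j * (n : ℤ) := by
  classical
  let Lf : J → (J →₀ ℕ) → ℤ := fun i β => β.sum fun j n => G i j * (n : ℤ)
  have Ladd (i β γ) : Lf i (β + γ) = Lf i β + Lf i γ :=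
    Finsupp.sum_add_index' (by simp) (by intros; push_cast; ring)
  have Lsingle (i j) : Lf i (Finsupp.single j 1) = G i j := by simp [Lf]
  let Q : (J →₀ ℕ) → (J →₀ ℕ) → ℤ := fun β γ => β.sum fun i n => (n : ℤ) * Lf i γ
  have Qaddl (β β' γ) : Q (β + β') γ = Q β γ + Q β' γ :=
    Finsupp.sum_add_index' (by simp) (by intros; push_cast; ring)
  have Qaddr (β γ γ') : Q β (γ + γ') = Q β γ + Q β γ' := by
    simp only [Q, Ladd, mul_add, Finsupp.sum_add]
  have Qsl (i γ) : Q (Finsupp.single i 1) γ = Lf i γ := by simp [Q]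
  have Qsr (i β) : Q β (Finsupp.single i 1) = Lf i β := by
    simp only [Q, Lsingle, Lf]
    exact Finsupp.sum_congr fun j _ => by rw [hG, mul_comm]
  let D : (J →₀ ℕ) → ℤ := fun β => β.sum fun i n => G i i * (n : ℤ)
  have Dadd (β γ) : D (β + γ) = D β + D γ :=
    Finsupp.sum_add_index' (by simp) (by intros; push_cast; ring)
  have Ds (i) : D (Finsupp.single i 1) = G i i := by simp [D]
  refine ⟨fun β => (Q β β - D β) / 2, by simp [Q, D], fun i β => ?_⟩
  have : Q (β + Finsupp.single i 1) (β + Finsupp.single i 1) - D (β + Finsupp.single i 1) =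
      (Q β β - D β) + Lf i β * 2 := by
    rw [Qaddl, Qaddr, Qaddr, Qsl, Qsr, Qsl, Lsingle, Dadd, Ds]; ring
  simp only [this]
  rw [Int.add_mul_ediv_right _ _ (by norm_num)]

/-- There is exactly one function `Ψ : Q⁻ → kˣ` (written as a function of `β ∈ Q⁺`, the negative
of its argument) with `Ψ(0) = 1` and `Ψ(-β - α_i) = a_i(-β)⁻¹ Ψ(-β)`. -/
theorem existsUnique_Psi : ∃! Ψ : (I →₀ ℕ) → BaseRingˣ, Ψ 0 = 1 ∧
    ∀ i β, Ψ (β + Finsupp.single i 1) = (aFun S i β)⁻¹ * Ψ β := by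
  classical
  obtain ⟨E, hE0, hE⟩ := exists_quadratic (fun i j => S.d i * S.a i j) S.d_symm
  obtain ⟨F, hF0, hF⟩ := exists_quadratic
    (fun i j : I => if i = j then (S.parity i : ℤ) else 0) (fun i j => by
      by_cases h : i = j
      · subst h; rfl
      · have h' : j ≠ i := fun e => h e.symm
        simp [h, h'])
  have huniq (Ψ Ψ' : (I →₀ ℕ) → BaseRingˣ)
      (h : ∀ i β, Ψ (β + Finsupp.single i 1) = (aFun S i β)⁻¹ * Ψ β)
      (h' : ∀ i β, Ψ' (β + Finsupp.single i 1) = (aFun S i β)⁻¹ * Ψ' β) (β : I →₀ ℕ) :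
      ∀ γ, Ψ γ = Ψ' γ → Ψ (γ + β) = Ψ' (γ + β) := by
    induction β using Finsupp.induction_linear with
    | zero => intro γ hγ; simpa using hγ
    | add β β' hβ hβ' => intro γ hγ; rw [← add_assoc]; exact hβ' _ (hβ _ hγ)
    | single j n =>
      intro γ hγ
      induction n with
      | zero => simpa using hγ
      | succ n ih => rw [Finsupp.single_add, ← add_assoc, h, h', ih]
  have hex : (S.q ^ E 0 * piUnit ^ F 0)⁻¹ = 1 ∧ ∀ i β,
      (S.q ^ E (β + Finsupp.single i 1) * piUnit ^ F (β + Finsupp.single i 1))⁻¹ =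
        (aFun S i β)⁻¹ * (S.q ^ E β * piUnit ^ F β)⁻¹ := by
    refine ⟨by simp [hE0, hF0], fun i β => ?_⟩
    rw [aFun_eq, ← mul_inv, hE, hF, zpow_add, zpow_add]
    congr 1
    ac_rfl
  refine ⟨fun β => (S.q ^ E β * piUnit ^ F β)⁻¹, hex, ?_⟩
  rintro Ψ ⟨h0, h1⟩
  funext β
  have h := huniq Ψ (fun β => (S.q ^ E β * piUnit ^ F β)⁻¹) h1 hex.2 β 0 (h0.trans hex.1.symm)
  simpa using h

/-- The function `Ψ`, as a function of `β ∈ Q⁺`: the value is `Ψ(-β)`. -/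
def Psi : (I →₀ ℕ) → BaseRingˣ := (existsUnique_Psi S).choose

theorem Psi_zero : Psi S 0 = 1 := (existsUnique_Psi S).choose_spec.1.1

theorem Psi_add_single (i : I) (β : I →₀ ℕ) :
    Psi S (β + Finsupp.single i 1) = (aFun S i β)⁻¹ * Psi S β :=
  (existsUnique_Psi S).choose_spec.1.2 i β

/-! ### The category `𝒪^P(𝐔)` -/

/-- The weight space `𝐔_γ`: the span of all products of generators of total weight `γ`. -/
def rootSpace (γ : P) : Submodule BaseRing (U S) :=
  Submodule.span BaseRing
    {x | ∃ l : List (Gen I), (l.map (Gen.wt S)).sum = γ ∧ (l.map (U.ofGen S)).prod = x}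

open Classical in
/-- A `𝐔`-module `M` with weight spaces `V λ` (`λ ∈ P`) is an object of `𝒪^P(𝐔)`. -/
structure IsCategoryO {M : Type*} [AddCommGroup M] [Module BaseRing M] [Module (U S) M]
    (V : P → Submodule BaseRing M) : Prop where
  isInternal : DirectSum.IsInternal V
  smul_mem : ∀ γ l : P, ∀ x ∈ rootSpace S γ, ∀ m ∈ V l, x • m ∈ V (l + γ)
  K_smul : ∀ (i : I) (l : P), ∀ m ∈ V l, U.K S i • m = (S.p i ^ S.h i l) • m
  finite : ∀ l, Module.Finite BaseRing (V l)
  bounded : ∃ T : Finset P, ∀ l, V l ≠ ⊥ → ∃ μ ∈ T, ∃ β : I →₀ ℕ, l = μ - S.rootOf β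

/-! ### The quantum Casimir operator -/

/-- The power `q^x = v^{N x}`, for `x ∈ (1/N) ℤ`. -/
def qPow (x : ℚ) : BaseRingˣ := vUnit ^ (x * S.N).num

section Casimir

variable {M : Type*} [AddCommGroup M] [Module BaseRing M] [Module (U S) M]

open Classical in
/-- The operator on `M = ⨁ V λ` that acts by the scalar `c λ` on `V λ`. -/
def scalarOn {V : P → Submodule BaseRing M} (hV : DirectSum.IsInternal V)
    (c : P → BaseRingˣ) : M →ₗ[BaseRing] M :=
  DirectSum.toModule BaseRing P M (fun l => (c l : BaseRing) • (V l).subtype) ∘ₗ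
    (LinearEquiv.ofBijective (DirectSum.coeLinearMap V) hV).symm.toLinearMap

/-- The operator `Ξ`, acting by `t(λ) q^{(λ+ρ|λ+ρ) - (ρ|ρ)}` on `V λ`. -/
def Xi (form : P →ₗ[ℤ] P →ₗ[ℤ] ℚ) (ρ : P) (t : P → BaseRingˣ)
    {V : P → Submodule BaseRing M} (hV : IsCategoryO S V) : M →ₗ[BaseRing] M :=
  scalarOn hV.isInternal fun l =>
    t l * qPow S (form (l + ρ) (l + ρ) - form ρ ρ)

/-- The term `Ψ(wt A_ν) A'_ν ψ(A_ν) m` of the sum `Φ m`; here `wt A_ν = -w ν`. -/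
def phiTerm {ν : Type*} (A A' : ν → Uminus S) (w : ν → I →₀ ℕ) (m : M) (n : ν) : M :=
  Psi S (w n) • ((A' n : U S) • (psi S (A n) • m))

/-- The operator `Φ = ∑_ν Ψ(wt A_ν) A'_ν ψ(A_ν)`. -/
def Phi {ν : Type*} (A A' : ν → Uminus S) (w : ν → I →₀ ℕ) (m : M) : M :=
  ∑ᶠ n, phiTerm S A A' w m n

/-- The quantum Casimir operator `Ω = Φ Ξ`. -/
def Omega (form : P →ₗ[ℤ] P →ₗ[ℤ] ℚ) (ρ : P) (t : P → BaseRingˣ)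
    {V : P → Submodule BaseRing M} (hV : IsCategoryO S V)
    {ν : Type*} (A A' : ν → Uminus S) (w : ν → I →₀ ℕ) (m : M) : M :=
  Phi S A A' w (Xi S form ρ t hV m)

end Casimir

end
end QuantumSuper

/-!
The operator `Φ` is built from the canonical elements `∑ A'_n ⊗ A_n` (sum over the indices of a
fixed weight `-β`) of the form on `𝐔⁻`. The form makes `E_i'` adjoint to left multiplication by
`f_i`, and `E_i^*` adjoint to right multiplication by `f_i`. Hence a skew derivation applied to one
leg of a canonical element can be traded for a multiplication by `f_i` in the other leg, at the cost
of passing from degree `β` to degree `β - α_i` (`IsDualPair.exchange_left`,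
`IsDualPair.exchange_right`).

Write `Φ = ∑ Φ_β`. Moving `e_i` from the left past `A'_n` by means of
`e_i R - τ_i(R) e_i = τ_i(E_i^* R) K_i - K_i⁻¹ E_i' R` and trading the skew derivations gives
`e_i Φ_β = X_β - X_{β-α_i} + Φ_{β-α_i} K_i² e_i`, where `X_β` is, up to a scalar, the sum of the
`A'_n e_i ψ(A_n)` (`IsDualPair.e_smul_part`). The recursion defining `Ψ` is what makes the
coefficients of the two `X`-terms match. On a vector of `M` only finitely many degrees matter, so
summing over `β` the `X`-terms telescope and `e_i Φ = Φ K_i² e_i` (`IsDualPair.e_smul_Phi`).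
Applying `ψ` to the same relation, one finds in the same way that `Φ f_i = f_i Φ K_i²`
(`IsDualPair.Phi_f_smul`). The factor `K_i²` is compensated by the ratio of the eigenvalues of `Ξ`
on adjacent weight spaces (`Xi_eigenvalue_add`).

These arguments use that the dual basis consists of weight vectors; this follows from the
orthogonality of the weight spaces (`IsCanonicalForm.orthogonal`). Uniqueness of `E_i^*` and `E_i'`
is never needed: any solutions of their defining equation have the adjunction property.
-/

namespace QuantumSuper

noncomputable section

variable {I P : Type*} [AddCommGroup P] (S : Setup I P)

/-! ### Weight spaces of `𝐔⁻` -/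

theorem eq_add_single_of_ne_zero {J : Type*} {i : J} {β : J →₀ ℕ} (h : β i ≠ 0) :
    ∃ γ, β = γ + Finsupp.single i 1 := by
  obtain ⟨γ, rfl⟩ := exists_add_of_le (Finsupp.single_le_iff.mpr (Nat.one_le_iff_ne_zero.mpr h))
  exact ⟨γ, add_comm _ _⟩

theorem one_mem_minusSpace : (1 : Uminus S) ∈ minusSpace S 0 :=
  Submodule.subset_span ⟨[], by simp, by simp⟩

variable {S}

theorem fMinus_mul_mem {β : I →₀ ℕ} {x : Uminus S} (hx : x ∈ minusSpace S β) (i : I) :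
    fMinus S i * x ∈ minusSpace S (β + Finsupp.single i 1) := by
  induction hx using Submodule.span_induction with
  | mem x h =>
    obtain ⟨l, rfl, rfl⟩ := h
    exact Submodule.subset_span ⟨i :: l, by simp [add_comm], by simp⟩
  | zero => simp
  | add x y _ _ hx hy => rw [mul_add]; exact add_mem hx hy
  | smul c x _ hx => rw [mul_smul_comm]; exact Submodule.smul_mem _ _ hx

theorem mul_fMinus_mem {β : I →₀ ℕ} {x : Uminus S} (hx : x ∈ minusSpace S β) (i : I) :
    x * fMinus S i ∈ minusSpace S (β + Finsupp.single i 1) := by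
  induction hx using Submodule.span_induction with
  | mem x h =>
    obtain ⟨l, rfl, rfl⟩ := h
    exact Submodule.subset_span ⟨l ++ [i], by simp, by simp⟩
  | zero => simp
  | add x y _ _ hx hy => rw [add_mul]; exact add_mem hx hy
  | smul c x _ hx => rw [smul_mul_assoc]; exact Submodule.smul_mem _ _ hx

/-- Induction on weight vectors of `𝐔⁻`: it suffices to treat `1` and left multiplication by the
`f_j`, provided the property is linear in the vector. -/
@[elab_as_elim]
theorem minusSpace_induction {C : ∀ (β : I →₀ ℕ) (x : Uminus S), x ∈ minusSpace S β → Prop}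
    (zero : ∀ β, C β 0 (zero_mem _))
    (add : ∀ β x y hx hy, C β x hx → C β y hy → C β (x + y) (add_mem hx hy))
    (smul : ∀ β (c : BaseRing) x hx, C β x hx → C β (c • x) (Submodule.smul_mem _ c hx))
    (one : C 0 1 (one_mem_minusSpace S))
    (mul : ∀ j β x hx, C β x hx →
      C (β + Finsupp.single j 1) (fMinus S j * x) (fMinus_mul_mem hx j))
    {β : I →₀ ℕ} {x : Uminus S} (hx : x ∈ minusSpace S β) : C β x hx := by
  induction hx using Submodule.span_induction with
  | mem x h =>
    obtain ⟨l, rfl, rfl⟩ := h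
    induction l with
    | nil => simpa using one
    | cons j l ih =>
      have h := mul j _ _ (Submodule.subset_span ⟨l, rfl, rfl⟩) ih
      simpa [add_comm] using h
  | zero => exact zero _
  | add x y hx hy h h' => exact add _ _ _ hx hy h h'
  | smul c x hx h => exact smul _ _ _ hx h

variable (S)

/-- The scalar `∏_j θ_{ji}^{n_j}` by which `twist S i` acts on `𝐔⁻_{-β}`, `β = ∑ n_j α_j`. -/
def thetaProd (i : I) (β : I →₀ ℕ) : BaseRingˣ := β.prod fun j n => S.θ j i ^ n

theorem aFun_eq_thetaProd (i : I) (β : I →₀ ℕ) :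
    aFun S i β = thetaProd S i β * S.p i ^ S.h i (S.rootOf β) := rfl

theorem thetaProd_zero (i : I) : thetaProd S i 0 = 1 := by simp [thetaProd]

theorem thetaProd_add_single (i j : I) (β : I →₀ ℕ) :
    thetaProd S i (β + Finsupp.single j 1) = thetaProd S i β * S.θ j i := by
  classical
  rw [thetaProd, Finsupp.prod_add_index' (by simp) (by intros; rw [pow_add]),
    Finsupp.prod_single_index (by simp), pow_one]; rfl

theorem thetaProd_mul_self (i : I) (β : I →₀ ℕ) : thetaProd S i β * thetaProd S i β = 1 := by
  rw [thetaProd, Finsupp.prod, ← Finset.prod_mul_distrib]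
  exact Finset.prod_eq_one fun j _ => by rw [← mul_pow, S.θ_mul_self, one_pow]

theorem thetaProd_inv (i : I) (β : I →₀ ℕ) : (thetaProd S i β)⁻¹ = thetaProd S i β :=
  inv_eq_of_mul_eq_one_right (thetaProd_mul_self S i β)

theorem rootOf_zero : S.rootOf 0 = 0 := by simp [Setup.rootOf]

theorem rootOf_single (i : I) : S.rootOf (Finsupp.single i 1) = S.α i := by
  simp [Setup.rootOf]

theorem h_rootOf_add_single (i j : I) (β : I →₀ ℕ) :
    S.h i (S.rootOf (β + Finsupp.single j 1)) = S.h i (S.rootOf β) + S.a i j := by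
  rw [rootOf_add, rootOf_single, map_add, S.pairing]

theorem rootOf_injective : Function.Injective S.rootOf := by
  intro β γ h
  have key (β : I →₀ ℕ) : S.rootOf β =
      Finsupp.linearCombination ℤ S.α (β.mapRange (Nat.cast : ℕ → ℤ) (by simp)) := by
    rw [Finsupp.linearCombination_apply, Finsupp.sum_mapRange_index (by simp)]
    simp [Setup.rootOf]
  rw [key, key] at h
  exact Finsupp.mapRange_injective _ _ Nat.cast_injective (S.α_linearIndependent h)

variable {S}

variable (S) in
theorem psi_ofGen (x : Gen I) : psi S (U.ofGen S x) = psiGen S x :=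
  (RingQuot.liftAlgHom_mkAlgHom_apply ..).trans (FreeAlgebra.lift_ι_apply ..)

variable (S) in
theorem twist_ofGen (i : I) (x : Gen I) : twist S i (U.ofGen S x) = twistGen S i x :=
  (RingQuot.liftAlgHom_mkAlgHom_apply ..).trans (FreeAlgebra.lift_ι_apply ..)

theorem twist_minus (i : I) {β : I →₀ ℕ} {x : Uminus S} (hx : x ∈ minusSpace S β) :
    twist S i x = thetaProd S i β • (x : U S) := by
  induction hx using minusSpace_induction with
  | zero => simp
  | add β x y _ _ hx hy => push_cast; rw [map_add, hx, hy, smul_add]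
  | smul β c x _ hx => push_cast; rw [map_smul, hx, smul_comm]
  | one => simp [thetaProd_zero]
  | mul j β x _ hx =>
    have h : twist S i (U.f S j) = S.θ j i • U.f S j :=
      twist_ofGen S i _
    push_cast
    rw [map_mul, hx, fMinus, h, thetaProd_add_single, smul_mul_smul_comm, mul_comm]

theorem K_mul_minus (i : I) {β : I →₀ ℕ} {x : Uminus S} (hx : x ∈ minusSpace S β) :
    U.K S i * x = (S.p i ^ (-S.h i (S.rootOf β))) • ((x : U S) * U.K S i) := by
  induction hx using minusSpace_induction with
  | zero => simp
  | add β x y _ _ hx hy => push_cast; rw [mul_add, hx, hy, ← smul_add, add_mul]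
  | smul β c x _ hx => push_cast; rw [mul_smul_comm, hx, smul_mul_assoc, smul_comm]
  | one => simp [rootOf_zero]
  | mul j β x _ hx =>
    push_cast
    rw [fMinus, ← mul_assoc, U.K_f, smul_mul_assoc, mul_assoc, hx, mul_smul_comm, smul_smul,
      ← zpow_add, h_rootOf_add_single, mul_assoc]
    congr 2
    ring

theorem psi_f (i : I) : psi S (U.f S i) = U.K S i * U.e S i :=
  psi_ofGen S _
theorem psi_e (i : I) : psi S (U.e S i) = U.f S i * U.Kinv S i :=
  psi_ofGen S _
theorem psi_K (i : I) : psi S (U.K S i) = U.Kinv S i :=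
  psi_ofGen S _
theorem psi_Kinv (i : I) : psi S (U.Kinv S i) = U.K S i :=
  psi_ofGen S _

theorem K_mul_psi (i : I) {β : I →₀ ℕ} {x : Uminus S} (hx : x ∈ minusSpace S β) :
    U.K S i * psi S x = (S.p i ^ (S.h i (S.rootOf β))) • (psi S x * U.K S i) := by
  induction hx using minusSpace_induction with
  | zero => simp
  | add β x y _ _ hx hy => push_cast; rw [map_add, mul_add, hx, hy, ← smul_add, add_mul]
  | smul β c x _ hx => push_cast; rw [map_smul, mul_smul_comm, hx, smul_mul_assoc, smul_comm]
  | one => simp [rootOf_zero]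
  | mul j β x _ hx =>
    push_cast
    rw [fMinus, map_mul, psi_f, ← mul_assoc, ← mul_assoc, U.K_comm, mul_assoc (U.K S j), U.K_e,
      mul_smul_comm, smul_mul_assoc, ← mul_assoc, mul_assoc (_ * _), hx, mul_smul_comm, smul_smul,
      ← zpow_add, h_rootOf_add_single, add_comm (S.a i j)]
    simp only [mul_assoc]

/-! ### The skew derivations `E_i^*` and `E_i'` -/

theorem isSkewDer_one (i : I) : IsSkewDer S i 1 0 0 := by simp [IsSkewDer]

/-- Existence of `E_i^*(x)` and `E_i'(x)` for a vector `x` of weight `-β`. They have weight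
`-β + α_i`, and vanish if `α_i` does not occur in `β`. -/
theorem exists_isSkewDer (i : I) {β : I →₀ ℕ} {x : Uminus S} (hx : x ∈ minusSpace S β) :
    ∃ Q R, IsSkewDer S i x Q R ∧ (β i = 0 → Q = 0 ∧ R = 0) ∧
      ∀ γ, β = γ + Finsupp.single i 1 → Q ∈ minusSpace S γ ∧ R ∈ minusSpace S γ := by
  classical
  induction hx using minusSpace_induction with
  | zero => exact ⟨0, 0, by simp [IsSkewDer], by simp, by simp⟩
  | add β x y _ _ hx hy =>
    obtain ⟨Q, R, h, h0, h1⟩ := hx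
    obtain ⟨Q', R', h', h0', h1'⟩ := hy
    refine ⟨Q + Q', R + R', ?_, fun hb => ?_, fun γ hγ => ?_⟩
    · unfold IsSkewDer at *
      push_cast
      rw [map_add, map_add, mul_add, mul_add, add_mul, add_mul, add_sub_add_comm, h, h',
        add_sub_add_comm]
    · simp [h0 hb, h0' hb]
    · exact ⟨add_mem (h1 γ hγ).1 (h1' γ hγ).1, add_mem (h1 γ hγ).2 (h1' γ hγ).2⟩
  | smul β c x _ hx =>
    obtain ⟨Q, R, h, h0, h1⟩ := hx
    refine ⟨c • Q, c • R, ?_, fun hb => ?_, fun γ hγ => ?_⟩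
    · unfold IsSkewDer at *
      push_cast
      simp only [map_smul, mul_smul_comm, smul_mul_assoc, ← smul_sub, h]
    · simp [h0 hb]
    · exact ⟨Submodule.smul_mem _ _ (h1 γ hγ).1, Submodule.smul_mem _ _ (h1 γ hγ).2⟩
  | one =>
    refine ⟨0, 0, isSkewDer_one i, by simp, by simp⟩
  | mul j β x hx ih =>
    obtain ⟨Q, R, h, h0, h1⟩ := ih
    have hmem (γ : I →₀ ℕ) (hγ : β + Finsupp.single j 1 = γ + Finsupp.single i 1)
        (y : Uminus S) (hy0 : β i = 0 → y = 0)
        (hy1 : ∀ γ, β = γ + Finsupp.single i 1 → y ∈ minusSpace S γ) :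
        fMinus S j * y ∈ minusSpace S γ := by
      by_cases hb : β i = 0
      · simp [hy0 hb]
      · obtain ⟨δ, rfl⟩ := eq_add_single_of_ne_zero hb
        have : γ = δ + Finsupp.single j 1 := by
          apply add_right_cancel (b := Finsupp.single i 1)
          rw [← hγ, add_right_comm]
        rw [this]
        exact fMinus_mul_mem (hy1 δ rfl) j
    -- The last summand is the value of the `e_i f_j` relation; it vanishes unless `i = j`.
    have key : U.e S i * (U.f S j * x) - twist S i (U.f S j * x) * U.e S i =
        twist S i (U.f S j * Q) * U.K S i -
          U.Kinv S i * ((S.θ j i * S.p i ^ (-S.a i j)) • (U.f S j * R)) +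
        (U.e S i * U.f S j - S.θ j i • (U.f S j * U.e S i)) * x := by
      have hf : twist S i (U.f S j) = S.θ j i • U.f S j :=
        twist_ofGen S i _
      have h' : U.e S i * x = twist S i x * U.e S i +
          (twist S i Q * U.K S i - U.Kinv S i * R) := by rw [← h]; abel
      have hK : U.Kinv S i * ((S.θ j i * S.p i ^ (-S.a i j)) • (U.f S j * R)) =
          S.θ j i • (U.f S j * (U.Kinv S i * R)) := by
        rw [← mul_assoc (U.f S j), U.f_Kinv, smul_mul_assoc, smul_smul, mul_smul_comm, mul_assoc]
      rw [hK, sub_mul, smul_mul_assoc, mul_assoc (U.f S j), h', map_mul, map_mul, hf]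
      simp only [mul_add, mul_sub, smul_add, smul_sub, smul_mul_assoc, mul_assoc]
      abel
    rw [U.e_f] at key
    by_cases hij : i = j
    · subst hij
      set c : BaseRing := Ring.inverse ((S.p i : BaseRing) - ((S.p i)⁻¹ : BaseRingˣ))
      rw [if_pos rfl] at key
      refine ⟨fMinus S i * Q +
          (c * (thetaProd S i β * S.p i ^ (-S.h i (S.rootOf β)) : BaseRingˣ)) • x,
        (S.θ i i * S.p i ^ (-S.a i i)) • (fMinus S i * R) + c • x, ?_, ?_, ?_⟩
      · unfold IsSkewDer
        have e1 : ((fMinus S i * x : Uminus S) : U S) = U.f S i * x := rfl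
        have e2 : ((fMinus S i * Q + (c * (thetaProd S i β *
            S.p i ^ (-S.h i (S.rootOf β)) : BaseRingˣ)) • x : Uminus S) : U S) =
            U.f S i * Q + (c * (thetaProd S i β *
            S.p i ^ (-S.h i (S.rootOf β)) : BaseRingˣ)) • (x : U S) := rfl
        have e3 : (((S.θ i i * S.p i ^ (-S.a i i)) • (fMinus S i * R) + c • x : Uminus S) : U S) =
            (S.θ i i * S.p i ^ (-S.a i i)) • (U.f S i * R) + c • (x : U S) := rfl
        have e4 : c • (U.K S i * x) = twist S i ((c * (thetaProd S i β *
            S.p i ^ (-S.h i (S.rootOf β)) : BaseRingˣ)) • (x : U S)) * U.K S i := by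
          rw [map_smul, twist_minus i hx, K_mul_minus i hx, Units.smul_def, Units.smul_def,
            smul_smul, smul_smul, smul_mul_assoc]
          congr 1
          have := thetaProd_mul_self S i β
          have h2 := congrArg Units.val this
          push_cast at h2 ⊢
          linear_combination (-(c * ((S.p i ^ (-S.h i (S.rootOf β)) : BaseRingˣ) : BaseRing))) * h2
        rw [e1, e2, e3, key, map_add (twist S i), add_mul, ← e4, mul_add, mul_smul_comm c,
          smul_mul_assoc, sub_mul, smul_sub]
        abel
      · intro hb; simp at hb
      · intro γ hγ
        have hβ : β = γ := add_right_cancel hγ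
        refine ⟨add_mem (hmem γ hγ Q (fun h => (h0 h).1) fun γ h => (h1 γ h).1)
            (Submodule.smul_mem _ _ (hβ ▸ hx)),
          add_mem ?_ (Submodule.smul_mem _ _ (hβ ▸ hx))⟩
        exact Submodule.smul_mem _ _ (hmem γ hγ R (fun h => (h0 h).2) fun γ h => (h1 γ h).2)
    · rw [if_neg hij, zero_mul, add_zero] at key
      refine ⟨fMinus S j * Q, (S.θ j i * S.p i ^ (-S.a i j)) • (fMinus S j * R), key, ?_, ?_⟩
      · intro hb
        have hb' : β i = 0 := by
          rw [Finsupp.add_apply] at hb; omega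
        simp [h0 hb']
      · intro γ hγ
        refine ⟨hmem γ hγ Q (fun h => (h0 h).1) fun γ h => (h1 γ h).1, ?_⟩
        exact Submodule.smul_mem _ _ (hmem γ hγ R (fun h => (h0 h).2) fun γ h => (h1 γ h).2)

/-- For the canonical form, weight spaces of different weights are orthogonal. -/
theorem IsCanonicalForm.orthogonal {B : LinearMap.BilinForm BaseRing (Uminus S)}
    (hB : IsCanonicalForm S B) {β γ : I →₀ ℕ} {x y : Uminus S} (hx : x ∈ minusSpace S β)
    (hy : y ∈ minusSpace S γ) (hne : β ≠ γ) : B x y = 0 := by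
  induction hx using minusSpace_induction generalizing γ y with
  | zero => simp
  | add β x x' _ _ hx hx' => simp [hx hy hne, hx' hy hne]
  | smul β c x _ hx => simp [hx hy hne]
  | one =>
    induction hy using minusSpace_induction with
    | zero => simp
    | add γ y y' _ _ h h' => simp [h hne, h' hne]
    | smul γ c y _ h => simp [h hne]
    | one => exact absurd rfl hne
    | mul j γ y _ _ => rw [← hB.left j 1 0 0 (isSkewDer_one j), map_zero, LinearMap.zero_apply]
  | mul j β x hx ih =>
    obtain ⟨Q, R, h, h0, h1⟩ := exists_isSkewDer j hy
    rw [hB.symm, ← hB.left j y Q R h, hB.symm]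
    by_cases hb : γ j = 0
    · rw [(h0 hb).2, map_zero]
    · obtain ⟨δ, rfl⟩ := eq_add_single_of_ne_zero hb
      exact ih (h1 δ rfl).2 fun e => hne (by rw [e])

/-! ### Dual bases of weight vectors -/

/-- `B` is the canonical form, `A` is a basis of weight vectors of weights `-w n`, and `A'` is its
dual family. -/
structure IsDualPair {ν : Type*} (B : LinearMap.BilinForm BaseRing (Uminus S))
    (A : Module.Basis ν BaseRing (Uminus S)) (A' : ν → Uminus S) (w : ν → I →₀ ℕ) : Prop where
  form : IsCanonicalForm S B
  mem : ∀ n, A n ∈ minusSpace S (w n)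
  dual : ∀ m n, B (A' m) (A n) = open Classical in if m = n then 1 else 0

namespace IsDualPair

variable {ν : Type*} {B : LinearMap.BilinForm BaseRing (Uminus S)}
  {A : Module.Basis ν BaseRing (Uminus S)} {A' : ν → Uminus S} {w : ν → I →₀ ℕ}
  (D : IsDualPair B A A' w)

include D

theorem apply_eq_repr (n : ν) (x : Uminus S) : B (A' n) x = A.repr x n := by
  classical
  conv_lhs => rw [← A.linearCombination_repr x, Finsupp.linearCombination_apply, Finsupp.sum]
  simp +contextual [D.dual, eq_comm]

theorem eq_zero {x : Uminus S} (h : ∀ n, B x (A n) = 0) : x = 0 := by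
  have hx : B x = 0 := A.ext fun n => by simp [h]
  apply A.repr.injective
  ext n
  rw [← D.apply_eq_repr, D.form.symm, hx]
  simp

/-- Nondegeneracy of the form and orthogonality of the weight spaces show that each vector of the
dual basis has the same weight as its partner. -/
theorem dual_mem (n : ν) : A' n ∈ minusSpace S (w n) := by
  classical
  have hsum : (A.repr (A' n)).sum (fun k c => c • A k) = A' n := A.linearCombination_repr (A' n)
  set y := ∑ k ∈ (A.repr (A' n)).support with w k = w n, A.repr (A' n) k • A k with hy
  have hmem : y ∈ minusSpace S (w n) := Submodule.sum_mem _ fun k hk =>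
    Submodule.smul_mem _ _ ((Finset.mem_filter.mp hk).2 ▸ D.mem k)
  have hdiff : A' n - y =
      ∑ k ∈ (A.repr (A' n)).support with ¬ w k = w n, A.repr (A' n) k • A k := by
    rw [sub_eq_iff_eq_add, add_comm, hy, Finset.sum_filter_add_sum_filter_not]
    exact hsum.symm
  have h0 : A' n - y = 0 := by
    refine D.eq_zero fun k => ?_
    by_cases hk : w k = w n
    · rw [hdiff, map_sum, LinearMap.sum_apply]
      refine Finset.sum_eq_zero fun l hl => ?_
      rw [map_smul, LinearMap.smul_apply, D.form.orthogonal (D.mem l) (D.mem k)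
        fun e => (Finset.mem_filter.mp hl).2 (e.trans hk), smul_zero]
    · rw [map_sub, LinearMap.sub_apply, D.dual, if_neg (fun e => hk (by rw [e])),
        D.form.orthogonal hmem (D.mem k) (fun e => hk e.symm), sub_zero]
  rw [sub_eq_zero.mp h0]
  exact hmem

theorem repr_eq_zero {β : I →₀ ℕ} {x : Uminus S} (hx : x ∈ minusSpace S β) {n : ν}
    (hn : w n ≠ β) : A.repr x n = 0 := by
  rw [← D.apply_eq_repr]
  exact D.form.orthogonal (D.dual_mem n) hx hn

theorem finite_level [Nontrivial BaseRing] (β : I →₀ ℕ) : {n | w n = β}.Finite := by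
  have hs : {l : List I | (l.map fun i => Finsupp.single i 1).sum = β}.Finite := by
    refine (List.finite_toSet (Finsupp.toMultiset β).toList.permutations).subset fun l hl => ?_
    have h (l : List I) :
        Finsupp.toMultiset (l.map fun i => Finsupp.single i 1).sum = (l : Multiset I) := by
      induction l with
      | nil => simp
      | cons i l ih => simp [ih]
    rw [Set.mem_ofPred_eq, List.mem_permutations, ← Multiset.coe_eq_coe, ← h l, hl,
      Multiset.coe_toList]
  refine (hs.biUnion fun l _ =>
    (A.repr ((l.map (fMinus S)).prod)).support.finite_toSet).subset fun n hn => ?_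
  by_contra hcon
  have h0 : ∀ x ∈ minusSpace S β, A.repr x n = 0 := fun x hx => by
    induction hx using Submodule.span_induction with
    | mem x h =>
      obtain ⟨l, hl, rfl⟩ := h
      by_contra hne
      exact hcon (Set.mem_biUnion (show l ∈ {l : List I | _} from hl)
        (Finsupp.mem_support_iff.mpr hne))
    | zero => simp
    | add x y _ _ hx hy => simp [hx, hy]
    | smul c x _ hx => simp [hx]
  have h1 := h0 (A n) (hn ▸ D.mem n)
  simp at h1

/-- The finite set of indices of weight `-β`. -/
def level [Nontrivial BaseRing] (β : I →₀ ℕ) : Finset ν := (D.finite_level β).toFinset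

theorem mem_level [Nontrivial BaseRing] {β : I →₀ ℕ} {n : ν} : n ∈ D.level β ↔ w n = β := by
  simp [level]

variable [Nontrivial BaseRing]

theorem sum_apply_smul {β : I →₀ ℕ} {x : Uminus S} (hx : x ∈ minusSpace S β) :
    ∑ n ∈ D.level β, B x (A' n) • A n = x := by
  classical
  conv_rhs => rw [← A.linearCombination_repr x, Finsupp.linearCombination_apply,
    Finsupp.sum_of_support_subset _ (s := D.level β) (fun n hn => by
      rw [mem_level]
      by_contra h
      exact Finsupp.mem_support_iff.mp hn (D.repr_eq_zero hx h)) _ (by simp)]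
  exact Finset.sum_congr rfl fun n _ => by rw [D.form.symm, D.apply_eq_repr]

theorem sum_apply_smul_dual {β : I →₀ ℕ} {x : Uminus S} (hx : x ∈ minusSpace S β) :
    ∑ n ∈ D.level β, B x (A n) • A' n = x := by
  classical
  refine sub_eq_zero.mp (D.eq_zero fun k => ?_)
  rw [map_sub, LinearMap.sub_apply, map_sum, LinearMap.sum_apply]
  simp only [map_smul, LinearMap.smul_apply, D.dual, smul_eq_mul, mul_ite, mul_one, mul_zero]
  rw [Finset.sum_ite_eq']
  split_ifs with h
  · rw [sub_self]
  · rw [zero_sub, D.form.orthogonal hx (D.mem k) fun e => h (D.mem_level.mpr e.symm), neg_zero]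

variable {M : Type*} [AddCommGroup M] [Module BaseRing M]

/-- If `E : 𝐔⁻_{-γ} → 𝐔⁻_{-β}` is adjoint to `T : 𝐔⁻_{-β} → 𝐔⁻_{-γ}`, then `E ⊗ 1` and `1 ⊗ T`
move the canonical element `∑ A'_n ⊗ A_n` of weight `γ`, respectively `β`, to the same tensor. -/
theorem exchange_left {β γ : I →₀ ℕ} (g : Uminus S →ₗ[BaseRing] Uminus S →ₗ[BaseRing] M)
    (Q : ν → Uminus S) (T : Uminus S → Uminus S)
    (hQ : ∀ n ∈ D.level γ, Q n ∈ minusSpace S β)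
    (hT : ∀ x ∈ minusSpace S β, T x ∈ minusSpace S γ)
    (hadj : ∀ n ∈ D.level γ, ∀ x, B (Q n) x = B (A' n) (T x)) :
    ∑ n ∈ D.level γ, g (Q n) (A n) = ∑ m ∈ D.level β, g (A' m) (T (A m)) := by
  have h1 : ∀ n ∈ D.level γ, g (Q n) (A n) =
      ∑ m ∈ D.level β, B (A' n) (T (A m)) • g (A' m) (A n) := fun n hn => by
    conv_lhs => rw [← D.sum_apply_smul_dual (hQ n hn)]
    rw [map_sum, LinearMap.sum_apply]
    exact Finset.sum_congr rfl fun m _ => by rw [map_smul, LinearMap.smul_apply, hadj n hn]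
  rw [Finset.sum_congr rfl h1, Finset.sum_comm]
  refine Finset.sum_congr rfl fun m hm => ?_
  conv_rhs => rw [← D.sum_apply_smul (hT _ (D.mem_level.mp hm ▸ D.mem m))]
  rw [map_sum]
  exact Finset.sum_congr rfl fun n _ => by rw [map_smul, D.form.symm]

/-- The mirror image of `exchange_left`. -/
theorem exchange_right {β γ : I →₀ ℕ} (g : Uminus S →ₗ[BaseRing] Uminus S →ₗ[BaseRing] M)
    (Q : ν → Uminus S) (T : Uminus S → Uminus S)
    (hQ : ∀ n ∈ D.level γ, Q n ∈ minusSpace S β)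
    (hT : ∀ x ∈ minusSpace S β, T x ∈ minusSpace S γ)
    (hadj : ∀ n ∈ D.level γ, ∀ x, B (Q n) x = B (A n) (T x)) :
    ∑ n ∈ D.level γ, g (A' n) (Q n) = ∑ m ∈ D.level β, g (T (A' m)) (A m) := by
  have h1 : ∀ n ∈ D.level γ, g (A' n) (Q n) =
      ∑ m ∈ D.level β, B (A n) (T (A' m)) • g (A' n) (A m) := fun n hn => by
    conv_lhs => rw [← D.sum_apply_smul (hQ n hn)]
    rw [map_sum]
    exact Finset.sum_congr rfl fun m _ => by rw [map_smul, hadj n hn]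
  rw [Finset.sum_congr rfl h1, Finset.sum_comm]
  refine Finset.sum_congr rfl fun m hm => ?_
  conv_rhs => rw [← D.sum_apply_smul_dual (hT _ (D.mem_level.mp hm ▸ D.dual_mem m))]
  rw [map_sum, LinearMap.sum_apply]
  exact Finset.sum_congr rfl fun n _ => by rw [map_smul, LinearMap.smul_apply, D.form.symm]

end IsDualPair

/-! ### Commuting the generators past the graded pieces of `Φ` -/

theorem h_rootOf_add_single_self (i : I) (β : I →₀ ℕ) :
    S.h i (S.rootOf (β + Finsupp.single i 1)) = S.h i (S.rootOf β) + 2 := by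
  rw [h_rootOf_add_single, S.a_diag]

theorem thetaProd_add_single_self (i : I) (β : I →₀ ℕ) :
    thetaProd S i (β + Finsupp.single i 1) = thetaProd S i β := by
  rw [thetaProd_add_single, S.θ_self, mul_one]

theorem Kinv_mul_minus_mul_K (i : I) {β : I →₀ ℕ} {x : Uminus S} (hx : x ∈ minusSpace S β) :
    U.Kinv S i * (x * U.K S i) = (S.p i ^ S.h i (S.rootOf β)) • (x : U S) := by
  have h : (x : U S) * U.K S i = (S.p i ^ S.h i (S.rootOf β)) • (U.K S i * x) := by
    rw [K_mul_minus i hx, smul_smul, ← zpow_add, add_neg_cancel, zpow_zero, one_smul]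
  rw [h, mul_smul_comm, ← mul_assoc, U.Kinv_mul_K, one_mul]

/-- The image under `ψ` of the defining relation of the skew derivations, solved for
`ψ(x) f_i`. -/
theorem psi_mul_f {i : I} {β γ : I →₀ ℕ} {x Q R : Uminus S} (h : IsSkewDer S i x Q R)
    (hx : x ∈ minusSpace S β) (hQ : Q ∈ minusSpace S γ) (hR : R ∈ minusSpace S γ)
    (hθ : thetaProd S i β = thetaProd S i γ) :
    psi S x * U.f S i =
      (aFun S i β)⁻¹ • (U.f S i * psi S x) - psi S Q +
        (thetaProd S i γ * S.p i ^ S.h i (S.rootOf γ)) •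
          (psi S R * (U.K S i * U.K S i)) := by
  have h1 := congrArg (fun y => thetaProd S i γ • (psi S y * U.K S i)) h
  simp only [map_sub, map_mul, psi_e, psi_K, psi_Kinv, twist_minus i hx, twist_minus i hQ,
    Units.smul_def, map_smul] at h1
  simp only [← Units.smul_def] at h1
  have h2 : U.f S i * U.Kinv S i * psi S x * U.K S i =
      S.p i ^ (-S.h i (S.rootOf β)) • (U.f S i * psi S x) := by
    have h3 : psi S x * U.K S i = S.p i ^ (-S.h i (S.rootOf β)) •
        (U.K S i * psi S x) := by
      rw [K_mul_psi i hx, smul_smul, ← zpow_add, neg_add_cancel, zpow_zero, one_smul]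
    rw [mul_assoc, h3, mul_smul_comm, mul_assoc, ← mul_assoc (U.Kinv S i), U.Kinv_mul_K, one_mul]
  rw [K_mul_psi i hR, sub_mul, h2, sub_mul] at h1
  simp only [smul_mul_assoc, mul_assoc, U.Kinv_mul_K, mul_one, smul_sub, smul_smul,
    hθ, thetaProd_mul_self, one_smul] at h1
  rw [aFun_eq_thetaProd, mul_inv, thetaProd_inv, hθ, ← zpow_neg]
  rw [sub_eq_iff_eq_add] at h1
  rw [h1]
  abel

section GradedPieces

variable {M : Type*} [AddCommGroup M] [Module BaseRing M] [Module (U S) M]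
  [IsScalarTower BaseRing (U S) M]

/-- The bilinear map `(x, y) ↦ x ψ(y) m`. -/
def sandwich (m : M) : Uminus S →ₗ[BaseRing] Uminus S →ₗ[BaseRing] M :=
  LinearMap.mk₂ BaseRing (fun x y => (x : U S) • (psi S y • m))
    (fun x x' y => by push_cast; rw [add_smul])
    (fun c x y => by push_cast; rw [smul_assoc])
    (fun x y y' => by push_cast; rw [map_add, add_smul, smul_add])
    (fun c x y => by push_cast; rw [map_smul, smul_assoc, smul_comm])

theorem sandwich_apply (m : M) (x y : Uminus S) :
    sandwich m x y = (x : U S) • (psi S y • m) := rfl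

namespace IsDualPair

variable {ν : Type*} {B : LinearMap.BilinForm BaseRing (Uminus S)}
  {A : Module.Basis ν BaseRing (Uminus S)} {A' : ν → Uminus S} {w : ν → I →₀ ℕ}
  (D : IsDualPair B A A' w) [Nontrivial BaseRing]

/-- The sum `∑ A'_n u ψ(A_n) m` over the basis vectors of weight `-β`. For `u = 1` this is, up to
the factor `Ψ(-β)`, the part of `Φ m` of degree `β`. -/
def part (u : U S) (β : I →₀ ℕ) (m : M) : M :=
  ∑ n ∈ D.level β, (A' n : U S) • (u • (psi S (A n) • m))

omit [Module BaseRing M] [IsScalarTower BaseRing (U S) M] in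
theorem part_smul {R : Type*} [Monoid R] [DistribMulAction R M] [SMulCommClass R (U S) M]
    (u : U S) (β : I →₀ ℕ) (c : R) (m : M) : D.part u β (c • m) = c • D.part u β m := by
  simp only [part, Finset.smul_sum]
  exact Finset.sum_congr rfl fun n _ => by
    rw [smul_comm c, smul_comm c, smul_comm c]

omit [Module BaseRing M] [IsScalarTower BaseRing (U S) M] in
theorem part_eq_zero (u : U S) {β : I →₀ ℕ} {m : M}
    (h : ∀ x ∈ minusSpace S β, psi S x • m = 0) : D.part u β m = 0 :=
  Finset.sum_eq_zero fun n hn => by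
    rw [h _ (D.mem_level.mp hn ▸ D.mem n), smul_zero, smul_zero]

/-- Moving `e_i` past the part of degree `γ + α_i`. After multiplication by `Ψ` the terms
`D.part (U.e S i) _ m` in degrees `γ + α_i` and `γ` are consecutive terms of a telescoping sum. -/
theorem e_smul_part (i : I) (γ : I →₀ ℕ) (m : M) :
    U.e S i • D.part 1 (γ + Finsupp.single i 1) m =
      thetaProd S i γ • D.part (U.e S i) (γ + Finsupp.single i 1) m +
      (thetaProd S i γ * S.p i ^ S.h i (S.rootOf (γ + Finsupp.single i 1))) •
        D.part 1 γ (U.K S i • U.e S i • U.K S i • m) -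
      S.p i ^ S.h i (S.rootOf γ) • D.part (U.e S i) γ m := by
  have hex (n : ν) := exists_isSkewDer i (D.dual_mem n)
  choose Q R hQR _ hmem using hex
  have hterm : ∀ n ∈ D.level (γ + Finsupp.single i 1),
      U.e S i • ((A' n : U S) • ((1 : U S) • (psi S (A n) • m))) =
      thetaProd S i γ • ((A' n : U S) • (U.e S i • (psi S (A n) • m))) +
      (thetaProd S i γ * S.p i ^ S.h i (S.rootOf (γ + Finsupp.single i 1))) •
        sandwich (U.K S i • m) (Q n) (A n) -
      U.Kinv S i • sandwich m (R n) (A n) := fun n hn => by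
    have hw := D.mem_level.mp hn
    have h1 : U.e S i * A' n = thetaProd S i γ • ((A' n : U S) * U.e S i) +
        thetaProd S i γ • ((Q n : U S) * U.K S i) - U.Kinv S i * R n := by
      have h := hQR n
      rw [IsSkewDer, twist_minus i (hw ▸ D.dual_mem n), twist_minus i (hmem n γ hw).1,
        thetaProd_add_single_self, sub_eq_iff_eq_add, smul_mul_assoc, smul_mul_assoc] at h
      rw [h]
      abel
    have h2 := K_mul_psi i (hw ▸ D.mem n)
    rw [one_smul, ← mul_smul, h1, sub_smul, add_smul, smul_assoc, smul_assoc, mul_smul, mul_smul,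
      mul_smul, ← mul_smul (U.K S i), h2, smul_assoc, mul_smul,
      smul_comm (Q n : U S) (_ : BaseRingˣ), sandwich_apply, sandwich_apply, mul_smul (thetaProd S i γ)]
  rw [part, Finset.smul_sum, Finset.sum_congr rfl hterm, Finset.sum_sub_distrib,
    Finset.sum_add_distrib, ← Finset.smul_sum, ← Finset.smul_sum, ← Finset.smul_sum,
    D.exchange_left (sandwich (U.K S i • m)) Q (· * fMinus S i)
      (fun n hn => (hmem n γ (D.mem_level.mp hn)).1) (fun x hx => mul_fMinus_mem hx i)
      (fun n _ x => D.form.right i _ _ _ (hQR n) x),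
    D.exchange_left (sandwich m) R (fMinus S i * ·)
      (fun n hn => (hmem n γ (D.mem_level.mp hn)).2) (fun x hx => fMinus_mul_mem hx i)
      (fun n _ x => D.form.left i _ _ _ (hQR n) x)]
  congr 2
  · congr 1
    refine Finset.sum_congr rfl fun n _ => ?_
    rw [sandwich_apply, one_smul]
    push_cast
    rw [fMinus, map_mul, psi_f, mul_smul, mul_smul]
  · rw [part, Finset.smul_sum, Finset.smul_sum]
    refine Finset.sum_congr rfl fun n hn => ?_
    rw [sandwich_apply]
    push_cast
    rw [fMinus, map_mul, psi_f, mul_smul, mul_smul, ← mul_smul (A' n : U S), ← mul_smul,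
      Kinv_mul_minus_mul_K i (D.mem_level.mp hn ▸ D.dual_mem n), smul_assoc]

/-- If `α_i` does not occur in `β`, the skew derivations kill the `A'_n` and no term of lower degree
appears. -/
theorem e_smul_part_of_eq_zero {i : I} {β : I →₀ ℕ} (hβ : β i = 0) (m : M) :
    U.e S i • D.part 1 β m = thetaProd S i β • D.part (U.e S i) β m := by
  rw [part, part, Finset.smul_sum, Finset.smul_sum]
  refine Finset.sum_congr rfl fun n hn => ?_
  have hw := D.mem_level.mp hn
  obtain ⟨Q, R, h, h0, -⟩ := exists_isSkewDer i (D.dual_mem n)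
  obtain ⟨rfl, rfl⟩ := h0 (hw ▸ hβ)
  rw [IsSkewDer, twist_minus i (hw ▸ D.dual_mem n), sub_eq_iff_eq_add] at h
  rw [one_smul, ← mul_smul, h]
  simp [mul_smul]

/-- Moving `f_i` past the part of degree `γ + α_i`; the counterpart of `e_smul_part`. -/
theorem part_f_smul (i : I) (γ : I →₀ ℕ) (m : M) :
    D.part 1 (γ + Finsupp.single i 1) (U.f S i • m) =
      (aFun S i (γ + Finsupp.single i 1))⁻¹ • D.part (U.f S i) (γ + Finsupp.single i 1) m -
      D.part (U.f S i) γ m +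
      (thetaProd S i γ * S.p i ^ S.h i (S.rootOf γ)) •
        U.f S i • D.part 1 γ (U.K S i • U.K S i • m) := by
  have hex (n : ν) := exists_isSkewDer i (D.mem n)
  choose Q R hQR _ hmem using hex
  have hterm : ∀ n ∈ D.level (γ + Finsupp.single i 1),
      (A' n : U S) • ((1 : U S) • (psi S (A n) • (U.f S i • m))) =
      (aFun S i (γ + Finsupp.single i 1))⁻¹ • ((A' n : U S) • (U.f S i • (psi S (A n) • m))) -
      sandwich m (A' n) (Q n) +
      (thetaProd S i γ * S.p i ^ S.h i (S.rootOf γ)) •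
        sandwich (U.K S i • U.K S i • m) (A' n) (R n) := fun n hn => by
    have hw := D.mem_level.mp hn
    rw [one_smul, ← mul_smul (psi S (A n)), psi_mul_f (hQR n) (hw ▸ D.mem n) (hmem n γ hw).1
      (hmem n γ hw).2 (thetaProd_add_single_self i γ), add_smul, sub_smul, smul_assoc,
      smul_assoc, smul_add, smul_sub, mul_smul,
      mul_smul, mul_smul, sandwich_apply, sandwich_apply, smul_comm (A' n : U S) (_ : BaseRingˣ),
      smul_comm (A' n : U S) (_ : BaseRingˣ), smul_comm (A' n : U S) (_ : BaseRingˣ),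
      mul_smul (U.K S i), mul_smul (thetaProd S i γ)]
  rw [part, Finset.sum_congr rfl hterm, Finset.sum_add_distrib,
    Finset.sum_sub_distrib, ← Finset.smul_sum, ← Finset.smul_sum,
    D.exchange_right (sandwich m) Q (· * fMinus S i)
      (fun n hn => (hmem n γ (D.mem_level.mp hn)).1) (fun x hx => mul_fMinus_mem hx i)
      (fun n _ x => D.form.right i _ _ _ (hQR n) x),
    D.exchange_right (sandwich (U.K S i • U.K S i • m)) R (fMinus S i * ·)
      (fun n hn => (hmem n γ (D.mem_level.mp hn)).2) (fun x hx => fMinus_mul_mem hx i)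
      (fun n _ x => D.form.left i _ _ _ (hQR n) x)]
  congr 2
  · refine Finset.sum_congr rfl fun n _ => ?_
    rw [sandwich_apply]
    push_cast
    rw [fMinus, mul_smul]
  · rw [part, Finset.smul_sum]
    refine Finset.sum_congr rfl fun n hn => ?_
    rw [sandwich_apply, one_smul]
    push_cast
    rw [fMinus, mul_smul]

theorem part_f_smul_of_eq_zero {i : I} {β : I →₀ ℕ} (hβ : β i = 0) (m : M) :
    D.part 1 β (U.f S i • m) = (aFun S i β)⁻¹ • D.part (U.f S i) β m := by
  rw [part, part, Finset.smul_sum]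
  refine Finset.sum_congr rfl fun n hn => ?_
  have hw := D.mem_level.mp hn
  obtain ⟨Q, R, h, h0, -⟩ := exists_isSkewDer i (D.mem n)
  obtain ⟨rfl, rfl⟩ := h0 (hw ▸ hβ)
  rw [one_smul, ← mul_smul (psi S (A n)), psi_mul_f h (hw ▸ D.mem n) (zero_mem (minusSpace S β))
    (zero_mem _) rfl]
  simp [mul_smul, smul_comm (A' n : U S)]

end IsDualPair

end GradedPieces

/-! ### Local finiteness of `Φ` -/

section LocalFiniteness

variable {M : Type*} [AddCommGroup M] [Module BaseRing M] [Module (U S) M]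

variable (S) in
/-- The set of `β ∈ Q⁺` for which `ψ(𝐔⁻_{-β})` does not annihilate `m`. -/
def psiSupport (m : M) : Set (I →₀ ℕ) := {β | ∃ x ∈ minusSpace S β, psi S x • m ≠ 0}

omit [Module BaseRing M] in
theorem psi_smul_eq_zero {m : M} {β : I →₀ ℕ} (h : β ∉ psiSupport S m) {x : Uminus S}
    (hx : x ∈ minusSpace S β) : psi S x • m = 0 := by
  by_contra hne
  exact h ⟨x, hx, hne⟩

namespace IsCategoryO

variable {V : P → Submodule BaseRing M} (hV : IsCategoryO S V)
include hV

theorem e_smul_mem (i : I) {l : P} {m : M} (hm : m ∈ V l) : U.e S i • m ∈ V (l + S.α i) :=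
  hV.smul_mem (S.α i) l _ (Submodule.subset_span ⟨[.e i], by simp [Gen.wt], by simp⟩) m hm

theorem f_smul_mem (i : I) {l : P} {m : M} (hm : m ∈ V l) : U.f S i • m ∈ V (l - S.α i) := by
  rw [sub_eq_add_neg l]
  exact hV.smul_mem (-S.α i) l _
    (Submodule.subset_span ⟨[.f i], by simp [Gen.wt], by simp⟩) m hm

theorem psi_smul_mem [IsScalarTower BaseRing (U S) M] {β : I →₀ ℕ} {x : Uminus S}
    (hx : x ∈ minusSpace S β) {l : P} {m : M} (hm : m ∈ V l) :
    psi S x • m ∈ V (l + S.rootOf β) := by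
  induction hx using minusSpace_induction with
  | zero => simp
  | add β x y _ _ hx hy => push_cast; rw [map_add, add_smul]; exact add_mem hx hy
  | smul β c x _ hx => push_cast; rw [map_smul, smul_assoc]; exact Submodule.smul_mem _ _ hx
  | one => simpa [rootOf_zero] using hm
  | mul j β x _ hx =>
    push_cast
    have he := hV.e_smul_mem j hx
    rw [fMinus, map_mul, psi_f, mul_smul, mul_smul, hV.K_smul j _ _ he, rootOf_add, rootOf_single,
      ← add_assoc]
    exact Submodule.smul_mem _ _ he

/-- On a weight vector only finitely many degrees contribute, since the weights of `M` are bounded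
above and the simple roots are linearly independent. -/
theorem finite_psiSupport_of_mem [IsScalarTower BaseRing (U S) M] {l : P} {m : M} (hm : m ∈ V l) :
    (psiSupport S m).Finite := by
  classical
  obtain ⟨T, hT⟩ := hV.bounded
  have hfin (μ : P) : {β | ∃ δ : I →₀ ℕ, l + S.rootOf β = μ - S.rootOf δ}.Finite := by
    by_cases h : ∃ δ, S.rootOf δ = μ - l
    · obtain ⟨δ, hδ⟩ := h
      refine (Set.finite_Iic δ).subset ?_
      rintro β ⟨ε, hε⟩
      have : δ = β + ε := rootOf_injective S <| by
        rw [hδ, rootOf_add, sub_eq_iff_eq_add, sub_eq_iff_eq_add.mp hε.symm]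
        abel
      rw [this]
      exact Set.mem_Iic.mpr le_self_add
    · convert Set.finite_empty
      ext β
      simp only [Set.mem_ofPred_eq, Set.mem_empty_iff_false, iff_false]
      rintro ⟨ε, hε⟩
      refine h ⟨β + ε, ?_⟩
      rw [rootOf_add, eq_sub_iff_add_eq, ← eq_sub_iff_add_eq.mp hε]
      abel
  refine (T.finite_toSet.biUnion fun μ _ => hfin μ).subset ?_
  rintro β ⟨x, hx, hne⟩
  have hmem := hV.psi_smul_mem hx hm
  obtain ⟨μ, hμ, δ, hδ⟩ := hT (l + S.rootOf β) fun h => hne <| by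
    rw [h] at hmem
    exact (Submodule.mem_bot _).mp hmem
  exact Set.mem_biUnion hμ ⟨δ, hδ⟩

theorem induction_on {C : M → Prop} (m : M) (weight : ∀ l, ∀ m ∈ V l, C m) (zero : C 0)
    (add : ∀ m m', C m → C m' → C (m + m')) : C m := by
  classical
  refine Submodule.iSup_induction V (motive := C) ?_ weight zero add
  rw [hV.isInternal.submodule_iSup_eq_top]
  trivial

theorem finite_psiSupport [IsScalarTower BaseRing (U S) M] (m : M) : (psiSupport S m).Finite := by
  refine hV.induction_on m (fun l m hm => hV.finite_psiSupport_of_mem hm) ?_ ?_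
  · simp [psiSupport]
  · intro m m' h h'
    refine (h.union h').subset ?_
    rintro β ⟨x, hx, hne⟩
    by_contra hcon
    rw [Set.mem_union, not_or] at hcon
    exact hne (by rw [smul_add, psi_smul_eq_zero hcon.1 hx, psi_smul_eq_zero hcon.2 hx, add_zero])

end IsCategoryO

end LocalFiniteness

section Commutation

variable {M : Type*} [AddCommGroup M] [Module BaseRing M] [Module (U S) M]
  [IsScalarTower BaseRing (U S) M]

namespace IsDualPair

variable {ν : Type*} {B : LinearMap.BilinForm BaseRing (Uminus S)}
  {A : Module.Basis ν BaseRing (Uminus S)} {A' : ν → Uminus S} {w : ν → I →₀ ℕ}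
  (D : IsDualPair B A A' w) [Nontrivial BaseRing]

include D in
omit [IsScalarTower BaseRing (U S) M] in
theorem finite_support_phiTerm {m : M} (hm : (psiSupport S m).Finite) :
    (Function.support (phiTerm S A A' w m)).Finite := by
  refine (hm.biUnion fun β _ => D.finite_level β).subset fun n hn => ?_
  refine Set.mem_biUnion (x := w n) ⟨A n, D.mem n, fun h => hn ?_⟩ rfl
  rw [phiTerm, h, smul_zero, smul_zero]

omit [IsScalarTower BaseRing (U S) M] in
/-- `Φ m` as a sum of its graded pieces. -/
theorem Phi_eq_finsum {m : M} (hm : (psiSupport S m).Finite) :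
    Phi S A A' w m = ∑ᶠ β, Psi S β • D.part 1 β m := by
  classical
  rw [Phi, finsum_eq_sum_of_support_subset (s := hm.toFinset.biUnion D.level),
    finsum_eq_sum_of_support_subset (s := hm.toFinset), Finset.sum_biUnion]
  · refine Finset.sum_congr rfl fun β _ => ?_
    rw [part, Finset.smul_sum]
    exact Finset.sum_congr rfl fun n hn => by rw [phiTerm, D.mem_level.mp hn, one_smul]
  · intro β _ γ _ hne
    refine Finset.disjoint_left.mpr fun n hβ hγ => hne ?_
    rw [← D.mem_level.mp hβ, D.mem_level.mp hγ]
  · intro β hβ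
    rw [Set.Finite.coe_toFinset]
    by_contra h
    exact hβ (by simp only [D.part_eq_zero _ fun x hx => psi_smul_eq_zero h hx, smul_zero])
  · intro n hn
    rw [Finset.mem_coe, Finset.mem_biUnion]
    refine ⟨w n, hm.mem_toFinset.mpr ⟨A n, D.mem n, fun h => hn ?_⟩, D.mem_level.mpr rfl⟩
    rw [phiTerm, h, smul_zero, smul_zero]

omit [IsScalarTower BaseRing (U S) M] in
theorem finite_support_smul_part {m : M} (hm : (psiSupport S m).Finite) (u : U S)
    (c : (I →₀ ℕ) → BaseRingˣ) :
    (Function.support fun β => c β • D.part u β m).Finite := by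
  refine hm.subset fun β hβ => ?_
  by_contra h
  exact hβ (by simp only [D.part_eq_zero u fun x hx => psi_smul_eq_zero h hx, smul_zero])

end IsDualPair

/-- A telescoping sum over `Q⁺` in the direction of `α_i`. -/
theorem finsum_telescope {J N : Type*} [AddCommGroup N] (i : J) {Y H Z : (J →₀ ℕ) → N}
    (hH : (Function.support H).Finite) (hZ : (Function.support Z).Finite)
    (h0 : ∀ β, β i = 0 → Y β = H β)
    (h1 : ∀ γ, Y (γ + Finsupp.single i 1) = H (γ + Finsupp.single i 1) + (Z γ - H γ)) :
    ∑ᶠ β, Y β = ∑ᶠ β, Z β := by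
  -- `Y - H` lives on the image of the shift `σ`, where it is `Z - H`.
  set σ : (J →₀ ℕ) → (J →₀ ℕ) := fun γ => γ + Finsupp.single i 1 with hσ
  have hinj : Function.Injective σ := add_left_injective _
  have hσi (γ) : σ γ i ≠ 0 := by simp [hσ]
  have hG : Function.support (Y - H) ⊆ Set.range σ := fun β hβ => by
    have : β i ≠ 0 := fun h => hβ (by rw [Pi.sub_apply, h0 β h, sub_self])
    obtain ⟨γ, rfl⟩ := eq_add_single_of_ne_zero this
    exact ⟨γ, rfl⟩
  have hGσ (γ) : (Y - H) (σ γ) = Z γ - H γ := by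
    rw [Pi.sub_apply, hσ, h1]; abel
  have hGfin : (Function.support (Y - H)).Finite := by
    refine ((hZ.union hH).image σ).subset fun β hβ => ?_
    obtain ⟨γ, rfl⟩ := hG hβ
    refine ⟨γ, ?_, rfl⟩
    by_contra h
    rw [Set.mem_union, not_or, Function.notMem_support, Function.notMem_support] at h
    exact hβ (by rw [hGσ, h.1, h.2, sub_zero])
  have hsum : ∑ᶠ β, (Y - H) β = ∑ᶠ β, Z β - ∑ᶠ β, H β := by
    rw [← finsum_mem_univ, finsum_mem_inter_support_eq' (Y - H) Set.univ (Set.range σ)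
      (fun β hβ => by simp [show β ∈ Set.range σ from hG hβ]), finsum_mem_range hinj,
      finsum_congr hGσ, finsum_sub_distrib hZ hH]
  calc ∑ᶠ β, Y β = ∑ᶠ β, ((Y - H) β + H β) := finsum_congr fun β => by simp
    _ = ∑ᶠ β, Z β := by rw [finsum_add_distrib hGfin hH, hsum, sub_add_cancel]

/-! ### Commutation of `Φ` with the generators -/

namespace IsDualPair

variable {ν : Type*} {B : LinearMap.BilinForm BaseRing (Uminus S)}
  {A : Module.Basis ν BaseRing (Uminus S)} {A' : ν → Uminus S} {w : ν → I →₀ ℕ}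
  (D : IsDualPair B A A' w) [Nontrivial BaseRing]
  {V : P → Submodule BaseRing M} (hV : IsCategoryO S V)
include D hV

theorem Phi_add (m m' : M) :
    Phi S A A' w (m + m') = Phi S A A' w m + Phi S A A' w m' := by
  unfold Phi
  rw [← finsum_add_distrib (D.finite_support_phiTerm (hV.finite_psiSupport m))
    (D.finite_support_phiTerm (hV.finite_psiSupport m'))]
  exact finsum_congr fun n => by simp only [phiTerm, smul_add]

theorem Phi_smul (c : BaseRingˣ) (m : M) : Phi S A A' w (c • m) = c • Phi S A A' w m := by
  unfold Phi
  rw [smul_finsum' c (D.finite_support_phiTerm (hV.finite_psiSupport m))]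
  refine finsum_congr fun n => ?_
  simp only [phiTerm]
  rw [smul_comm _ c, smul_comm _ c, smul_comm _ c]

/-- On `M_λ`, `e_i Φ = Φ p_i^{2⟨h_i, λ⟩ + 4} e_i`, which is the identity `e_i Φ = Φ K_i^2 e_i`. -/
theorem e_smul_Phi (i : I) {l : P} {m : M} (hm : m ∈ V l) :
    U.e S i • Phi S A A' w m =
      (S.p i ^ (2 * S.h i l + 4)) • Phi S A A' w (U.e S i • m) := by
  have hfm := hV.finite_psiSupport m
  have hfe := hV.finite_psiSupport (U.e S i • m)
  rw [D.Phi_eq_finsum hfm, D.Phi_eq_finsum hfe,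
    smul_finsum' _ (D.finite_support_smul_part hfm 1 (Psi S)),
    smul_finsum' _ (D.finite_support_smul_part hfe 1 (Psi S))]
  have hZ := D.finite_support_smul_part hfe 1 fun β => S.p i ^ (2 * S.h i l + 4) * Psi S β
  simp only [mul_smul] at hZ
  refine finsum_telescope i (D.finite_support_smul_part hfm (U.e S i)
    fun β => Psi S β * thetaProd S i β) hZ (fun β hβ => ?_) (fun γ => ?_)
  · rw [smul_comm, D.e_smul_part_of_eq_zero hβ, mul_smul]
  · have hK : U.K S i • U.e S i • U.K S i • m = S.p i ^ (2 * S.h i l + 2) • U.e S i • m := by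
      rw [hV.K_smul i l m hm, smul_comm (U.e S i), smul_comm (U.K S i),
        hV.K_smul i _ _ (hV.e_smul_mem i hm), smul_smul, ← zpow_add, map_add, S.pairing, S.a_diag]
      congr 2
      ring
    rw [smul_comm, e_smul_part, hK, part_smul, smul_sub, smul_add, add_sub_assoc, smul_smul,
      smul_smul, smul_smul, smul_smul, smul_smul, thetaProd_add_single_self,
      h_rootOf_add_single_self, Psi_add_single, aFun_eq_thetaProd]
    congr 3
    · have hunits (x y b c : BaseRingˣ) : x⁻¹ * y * (x * b) * c = b * c * y := by
        rw [mul_mul_mul_comm x⁻¹, inv_mul_cancel, one_mul, mul_assoc, mul_comm]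
      rw [zpow_add _ _ 2, ← mul_assoc (thetaProd S i γ), hunits, ← zpow_add]
      congr 2
      ring
    · rw [mul_inv, thetaProd_inv, mul_right_comm, inv_mul_cancel_right, mul_comm]

/-- On `M_λ`, `Φ f_i = f_i Φ p_i^{2⟨h_i, λ⟩}`, which is the identity `Φ f_i = f_i Φ K_i^2`. -/
theorem Phi_f_smul (i : I) {l : P} {m : M} (hm : m ∈ V l) :
    Phi S A A' w (U.f S i • m) =
      (S.p i ^ (2 * S.h i l)) • U.f S i • Phi S A A' w m := by
  have hfm := hV.finite_psiSupport m
  have hff := hV.finite_psiSupport (U.f S i • m)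
  have hZ := D.finite_support_smul_part hfm 1 fun β => S.p i ^ (2 * S.h i l) * Psi S β
  simp only [mul_smul] at hZ
  have hZ' : (Function.support fun β => U.f S i • S.p i ^ (2 * S.h i l) • Psi S β •
      D.part 1 β m).Finite := hZ.subset fun β hβ h => hβ (by simp only [h, smul_zero])
  rw [D.Phi_eq_finsum hfm, D.Phi_eq_finsum hff, smul_comm,
    smul_finsum' _ (D.finite_support_smul_part hfm 1 (Psi S)), smul_finsum' _ hZ]
  refine finsum_telescope i (D.finite_support_smul_part hfm (U.f S i)
    fun β => Psi S β * (aFun S i β)⁻¹) hZ' (fun β hβ => ?_) (fun γ => ?_)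
  · rw [D.part_f_smul_of_eq_zero hβ, mul_smul]
  · have hK : U.K S i • U.K S i • m = S.p i ^ (2 * S.h i l) • m := by
      rw [hV.K_smul i l m hm, smul_comm (U.K S i), hV.K_smul i l m hm, smul_smul, ← zpow_add]
      congr 2
      ring
    rw [part_f_smul, hK, part_smul, sub_add_eq_add_sub, add_sub_assoc, smul_add, smul_sub]
    congr 1
    · rw [mul_smul]
    · congr 1
      · rw [smul_smul, smul_comm _ (U.f S i), smul_comm _ (S.p i ^ (2 * S.h i l)), Psi_add_single,
          aFun_eq_thetaProd, mul_right_comm, inv_mul_cancel, one_mul]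
      · rw [Psi_add_single, mul_comm]

end IsDualPair

end Commutation

/-! ### The operator `Ξ` -/

omit [AddCommGroup P] in
open Classical in
theorem scalarOn_apply {M : Type*} [AddCommGroup M] [Module BaseRing M]
    {V : P → Submodule BaseRing M} (hV : DirectSum.IsInternal V) (c : P → BaseRingˣ)
    {l : P} {m : M} (hm : m ∈ V l) : scalarOn hV c m = c l • m := by
  have h : (LinearEquiv.ofBijective (DirectSum.coeLinearMap V) hV).symm m =
      DirectSum.lof BaseRing P (fun l => V l) l ⟨m, hm⟩ := by
    rw [LinearEquiv.symm_apply_eq]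
    exact (DirectSum.coeLinearMap_lof V l ⟨m, hm⟩).symm
  rw [scalarOn, LinearMap.comp_apply, LinearEquiv.coe_coe, h, DirectSum.toModule_lof]
  rfl

theorem qPow_add_intCast {x : ℚ} (hx : ∃ z : ℤ, x * S.N = z) (k : ℤ) :
    qPow S (x + k) = qPow S x * S.q ^ k := by
  obtain ⟨z, hz⟩ := hx
  have h : (x + k) * S.N = ((z + S.N * k : ℤ) : ℚ) := by
    push_cast
    rw [← hz]
    ring
  rw [qPow, qPow, h, hz, Rat.num_intCast, Rat.num_intCast, zpow_add, zpow_mul, zpow_natCast,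
    Setup.q]

/-- The eigenvalues of `Ξ` on `M_λ` and `M_{λ+α_i}` differ by the factor `p_i^{2⟨h_i, λ⟩ + 4}`. -/
theorem Xi_eigenvalue_add {form : P →ₗ[ℤ] P →ₗ[ℤ] ℚ} (form_symm : ∀ l μ, form l μ = form μ l)
    (form_root : ∀ i l, form (S.α i) l = S.d i * S.h i l)
    {ρ : P} (hρ : ∀ i, S.h i ρ = 1)
    (hN : ∀ l, ∃ z : ℤ, (form (l + ρ) (l + ρ) - form ρ ρ) * S.N = z)
    {t : P → BaseRingˣ} (ht_root : ∀ i l, t l / t (l - S.α i) = S.piOf i ^ S.h i l)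
    (i : I) (l : P) :
    t (l + S.α i) * qPow S (form (l + S.α i + ρ) (l + S.α i + ρ) - form ρ ρ) =
      S.p i ^ (2 * S.h i l + 4) * (t l * qPow S (form (l + ρ) (l + ρ) - form ρ ρ)) := by
  have hα : S.h i (S.α i) = 2 := by rw [S.pairing, S.a_diag]
  have ht : t (l + S.α i) = S.piOf i ^ (S.h i l + 2) * t l := by
    have h := ht_root i (l + S.α i)
    rw [add_sub_cancel_right, map_add, hα, div_eq_iff_eq_mul] at h
    exact h
  have hform : form (l + S.α i + ρ) (l + S.α i + ρ) - form ρ ρ =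
      (form (l + ρ) (l + ρ) - form ρ ρ) + ((S.d i * (2 * S.h i l + 4) : ℤ) : ℚ) := by
    rw [add_right_comm, LinearMap.map_add₂, (form (l + ρ)).map_add (l + ρ),
      form_symm (l + ρ) (S.α i), form_root, form_root, map_add (S.h i) (l + ρ), map_add (S.h i) l,
      hα, hρ]
    push_cast
    ring
  have hp : S.p i ^ (2 * S.h i l + 4) =
      S.q ^ (S.d i * (2 * S.h i l + 4)) * S.piOf i ^ (S.h i l + 2) := by
    have h2 : S.sqrtPiOf i ^ (2 : ℤ) = S.piOf i := by exact_mod_cast S.sqrtPiOf_sq' i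
    rw [Setup.p, mul_zpow, ← zpow_mul, ← h2, ← zpow_mul]
    congr 2
    ring
  rw [ht, hform, qPow_add_intCast (hN l), hp]
  ac_rfl

end
end QuantumSuper


open QuantumSuper in
theorem mainTheorem9 {I P : Type*} [AddCommGroup P] [Module.Free ℤ P] (S : Setup I P)
    (form : P →ₗ[ℤ] P →ₗ[ℤ] ℚ) (form_symm : ∀ l μ, form l μ = form μ l)
    (form_root : ∀ i l, form (S.α i) l = S.d i * S.h i l)
    (ρ : P) (hρ : ∀ i, S.h i ρ = 1)
    (hN : ∀ l, ∃ z : ℤ, (form (l + ρ) (l + ρ) - form ρ ρ) * S.N = z)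
    (t : P → BaseRingˣ) (ht : ∀ l, t l = 1 ∨ t l = piUnit)
    (ht_root : ∀ i l, t l / t (l - S.α i) = S.piOf i ^ S.h i l)
    {ν : Type*} (A : Module.Basis ν BaseRing (Uminus S)) (w : ν → I →₀ ℕ)
    (hA : ∀ n, A n ∈ minusSpace S (w n))
    (A' : ν → Uminus S) (hA' : ∀ m n, canonicalForm S (A' m) (A n) = open Classical in
      if m = n then 1 else 0)
    {M : Type*} [AddCommGroup M] [Module BaseRing M] [Module (U S) M]
    [IsScalarTower BaseRing (U S) M] (V : P → Submodule BaseRing M) (hV : IsCategoryO S V) :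
    (∀ m : M, (Function.support (phiTerm S A A' w m)).Finite) ∧
    (∀ (i : I) (m : M), Omega S form ρ t hV A A' w (U.e S i • m) =
      U.e S i • Omega S form ρ t hV A A' w m) ∧
    (∀ (i : I) (m : M), Omega S form ρ t hV A A' w (U.f S i • m) =
      U.f S i • Omega S form ρ t hV A A' w m) := by
  rcases subsingleton_or_nontrivial M with hM | hM
  · refine ⟨fun m => ?_, fun _ _ => Subsingleton.elim _ _, fun _ _ => Subsingleton.elim _ _⟩
    convert Set.finite_empty
    ext n
    simp [Subsingleton.elim (phiTerm S A A' w m n) 0]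
  have hR : Nontrivial BaseRing := Module.nontrivial BaseRing M
  have hU : Nontrivial (U S) := Module.nontrivial (U S) M
  obtain ⟨n⟩ : Nonempty ν := A.index_nonempty
  -- A dual basis exists only for a nonzero form, so `canonicalForm` is not the default value `0`.
  have hform : IsCanonicalForm S (canonicalForm S) := by
    by_cases h : ∃ B, IsCanonicalForm S B
    · rw [canonicalForm, dif_pos h]
      exact h.choose_spec
    · have h1 := hA' n n
      rw [canonicalForm, dif_neg h] at h1
      simp at h1
  have D : IsDualPair (canonicalForm S) A A' w := ⟨hform, hA, hA'⟩
  have hXi {l : P} {m : M} (hm : m ∈ V l) := scalarOn_apply hV.isInternal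
    (fun l => t l * qPow S (form (l + ρ) (l + ρ) - form ρ ρ)) hm
  have hadd (m m' : M) : Omega S form ρ t hV A A' w (m + m') =
      Omega S form ρ t hV A A' w m + Omega S form ρ t hV A A' w m' := by
    rw [Omega, map_add, D.Phi_add hV]; rfl
  have hzero : Omega S form ρ t hV A A' w (0 : M) = 0 := by
    simpa using hadd 0 0
  have hwt {l : P} {m : M} (hm : m ∈ V l) : Omega S form ρ t hV A A' w m =
      (t l * qPow S (form (l + ρ) (l + ρ) - form ρ ρ)) • Phi S A A' w m := by
    rw [Omega, Xi, hXi hm, D.Phi_smul hV]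
  -- Both commutation relations are linear in `m`, so they may be checked on weight vectors.
  have hev := Xi_eigenvalue_add form_symm form_root hρ hN ht_root
  refine ⟨fun m => D.finite_support_phiTerm (hV.finite_psiSupport m), fun i m => ?_,
    fun i m => ?_⟩
  · refine hV.induction_on (C := fun m => Omega S form ρ t hV A A' w (U.e S i • m) =
      U.e S i • Omega S form ρ t hV A A' w m) m (fun l m hm => ?_) (by simp [hzero])
      (fun m m' h h' => by rw [smul_add, hadd, hadd, smul_add, h, h'])
    rw [hwt hm, hwt (hV.e_smul_mem i hm), hev, smul_comm (U.e S i), D.e_smul_Phi hV i hm, smul_smul,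
      mul_comm]
  · refine hV.induction_on (C := fun m => Omega S form ρ t hV A A' w (U.f S i • m) =
      U.f S i • Omega S form ρ t hV A A' w m) m (fun l m hm => ?_) (by simp [hzero])
      (fun m m' h h' => by rw [smul_add, hadd, hadd, smul_add, h, h'])
    have hl := hev i (l - S.α i)
    rw [sub_add_cancel, map_sub, S.pairing, S.a_diag] at hl
    rw [hwt hm, hwt (hV.f_smul_mem i hm), D.Phi_f_smul hV i hm, hl, smul_comm (U.f S i), smul_smul,
      mul_comm]
    congr 3
    ring
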